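/- Let $n\ge 1$. A weak (generalized) $\Phi$-function on $\mathbb R^n$, $\varphi\in\Phi_w(\mathbb R^n)$, is a function $\varphi:\mathbb R^n\times[0,\infty)\to[0,\infty]$ such that: $x\mapsto\varphi(x,|f(x)|)$ is measurable for every measurable $f:\mathbb R^n\to\mathbb R$; for every $x$, $t\mapsto\varphi(x,t)$ is non-decreasing, $\varphi(x,0)=\lim_{t\to0^+}\varphi(x,t)=0$ and $\lim_{t\to\infty}\varphi(x,t)=\infty$; and there is $L\ge1$ with $\frac{\varphi(x,s)}{s}\le L\,\frac{\varphi(x,t)}{t}$ for all $x$ and all $0<s<t$. Write $\varphi\in\Phi_w$ if $\varphi$ does not depend on $x$. Let $\varphi^{-1}(x,t)=\inf\{\tau\ge0:\varphi(x,\tau)\ge t\}$. Consider the conditions: (A0) there is $\beta\in(0,1]$ with $\beta\le\varphi^{-1}(x,1)\le\frac1\beta$ for almost every $x\in\mathbb R^n$; (A1) there is $\beta\in(0,1)$ such that for every ball $B$ with $|B|\le1$ and almost every $x,y\in B$, $\beta\varphi^{-1}(x,t)\le\varphi^{-1}(y,t)$ for every $t\in[1,\frac1{|B|}]$; (A2)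 there are $\varphi_\infty\in\Phi_w$, $h\in L^1(\mathbb R^n)\cap L^\infty(\mathbb R^n)$, $\beta\in(0,1]$ and $s>0$ such that for almost every $x\in\mathbb R^n$ and every $t\ge 0$: $\varphi(x,\beta t)\le\varphi_\infty(t)+h(x)$ whenever $\varphi_\infty(t)\in[0,s]$, and $\varphi_\infty(\beta t)\le\varphi(x,t)+h(x)$ whenever $\varphi(x,t)\in[0,s]$; (aInc) there are $p>1$ and $a\ge1$ such that $\frac{\varphi(x,t)}{t^p}\le a\,\frac{\varphi(x,s)}{s^p}$ for all $0<t<s$ and almost every $x\in\mathbb R^n$. Two functions $\varphi,\psi\in\Phi_w(\mathbb R^n)$ are weakly equivalent if there are $L\ge1$ and $h\in L^1(\mathbb R^n)$ such that $\psi(x,t)\le\varphi(x,Lt)+h(x)$ and $\varphi(x,t)\le\psi(x,Lt)+h(x)$ for all $t\ge0$ and almost every $x\in\mathbb R^n$. The space $L^\varphi(\mathbb R^n)$ consists of the measurable $f$ with $\int_{\mathbb R^n}\varphi(x,\lambda|f(x)|)\,dx<\infty$ for some $\lambda>0$, and is equipped with the quasinorm $\|f\|_\varphi=\inf\{\lambda>0:\int_{\mathbb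 R^n}\varphi(x,|f(x)|/\lambda)\,dx\le1\}$, where $\varphi(x,\infty):=\infty$. Let $Mf(x)=\sup_{B\ni x}\frac1{|B|}\int_B|f(y)|\,dy$, the supremum being over all open balls $B$ that contain $x$. The operator $M$ is bounded from $L^\varphi(\mathbb R^n)$ to $L^\varphi(\mathbb R^n)$ if there is a constant $K$ such that $Mf\in L^\varphi(\mathbb R^n)$ and $\|Mf\|_\varphi\le K\|f\|_\varphi$ for every $f\in L^\varphi(\mathbb R^n)$. **Theorem.** Let $\varphi\in\Phi_w(\mathbb R^n)$ satisfy (A0), (A1) and (A2). Then the Hardy–Littlewood maximal operator $M$ is bounded from $L^\varphi(\mathbb R^n)$ to $L^\varphi(\mathbb R^n)$ if and only if there exists $\psi\in\Phi_w(\mathbb R^n)$ such that $\varphi$ and $\psi$ are weakly equivalent and $\psi$ satisfies (A0), (A1), (A2) and (aInc). -/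

import Mathlib

open MeasureTheory Filter Topology
open scoped NNReal ENNReal

noncomputable section

namespace GenOrlicz

/-- `φ : ℝⁿ × [0, ∞) → [0, ∞]` is a weak (generalized) `Φ`-function on `ℝⁿ`. Measurability is
Lebesgue measurability (a function into `ℝ≥0` or `ℝ≥0∞` is Lebesgue measurable if and only if it is
`AEMeasurable` with respect to Lebesgue measure). -/
structure IsWeakPhi {n : ℕ} (φ : EuclideanSpace ℝ (Fin n) → ℝ≥0 → ℝ≥0∞) : Prop where
  measurable_comp : ∀ f : EuclideanSpace ℝ (Fin n) → ℝ≥0,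
    AEMeasurable f volume → AEMeasurable (fun x => φ x (f x)) volume
  monotone : ∀ x, Monotone (φ x)
  map_zero : ∀ x, φ x 0 = 0
  tendsto_zero : ∀ x, Tendsto (φ x) (𝓝[>] 0) (𝓝 0)
  tendsto_top : ∀ x, Tendsto (φ x) atTop (𝓝 ⊤)
  almost_increasing : ∃ L : ℝ≥0, 1 ≤ L ∧ ∀ x, ∀ s t : ℝ≥0, 0 < s → s < t →
    φ x s / s ≤ L * (φ x t / t)

/-- The generalized inverse `φ⁻¹(x, t) = inf {τ ≥ 0 : φ(x, τ) ≥ t}`, with `inf ∅ = ∞`. -/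
def genInv {n : ℕ} (φ : EuclideanSpace ℝ (Fin n) → ℝ≥0 → ℝ≥0∞)
    (x : EuclideanSpace ℝ (Fin n)) (t : ℝ≥0∞) : ℝ≥0∞ :=
  ⨅ (τ : ℝ≥0) (_ : t ≤ φ x τ), (τ : ℝ≥0∞)

/-- Condition (A0). -/
def A0 {n : ℕ} (φ : EuclideanSpace ℝ (Fin n) → ℝ≥0 → ℝ≥0∞) : Prop :=
  ∃ β : ℝ≥0, 0 < β ∧ β ≤ 1 ∧
    ∀ᵐ x ∂volume, (β : ℝ≥0∞) ≤ genInv φ x 1 ∧ genInv φ x 1 ≤ 1 / (β : ℝ≥0∞)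

/-- Condition (A1). -/
def A1 {n : ℕ} (φ : EuclideanSpace ℝ (Fin n) → ℝ≥0 → ℝ≥0∞) : Prop :=
  ∃ β : ℝ≥0, 0 < β ∧ β < 1 ∧
    ∀ (c : EuclideanSpace ℝ (Fin n)) (r : ℝ), 0 < r → volume (Metric.ball c r) ≤ 1 →
      ∀ᵐ x ∂(volume.restrict (Metric.ball c r)), ∀ᵐ y ∂(volume.restrict (Metric.ball c r)),
        ∀ t : ℝ≥0∞, 1 ≤ t → t ≤ 1 / volume (Metric.ball c r) →
          β * genInv φ x t ≤ genInv φ y t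

/-- Condition (A2). The function `h ∈ L¹ ∩ L^∞` is taken nonnegative: this is no restriction, since
the inequalities at `t = 0` force `h ≥ 0` almost everywhere. -/
def A2 {n : ℕ} (φ : EuclideanSpace ℝ (Fin n) → ℝ≥0 → ℝ≥0∞) : Prop :=
  ∃ (φinf : ℝ≥0 → ℝ≥0∞) (h : EuclideanSpace ℝ (Fin n) → ℝ≥0) (β s : ℝ≥0),
    IsWeakPhi (fun _ : EuclideanSpace ℝ (Fin n) => φinf) ∧
    MemLp (fun x => (h x : ℝ)) 1 volume ∧ MemLp (fun x => (h x : ℝ)) ⊤ volume ∧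
    0 < β ∧ β ≤ 1 ∧ 0 < s ∧
    ∀ᵐ x ∂volume, ∀ t : ℝ≥0,
      (φinf t ≤ s → φ x (β * t) ≤ φinf t + h x) ∧
      (φ x t ≤ s → φinf (β * t) ≤ φ x t + h x)

/-- Condition (aInc)`_p`: `φ(x, t) / t ^ p` is almost increasing in `t > 0`, uniformly for almost
every `x`. -/
def AIncExp {n : ℕ} (φ : EuclideanSpace ℝ (Fin n) → ℝ≥0 → ℝ≥0∞) (p : ℝ) : Prop :=
  ∃ a : ℝ≥0, 1 ≤ a ∧ ∀ᵐ x ∂volume, ∀ t s : ℝ≥0, 0 < t → t < s →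
    φ x t / (t : ℝ≥0∞) ^ p ≤ a * (φ x s / (s : ℝ≥0∞) ^ p)

/-- Condition (aInc): (aInc)`_p` holds for some `p > 1`. -/
def AInc {n : ℕ} (φ : EuclideanSpace ℝ (Fin n) → ℝ≥0 → ℝ≥0∞) : Prop :=
  ∃ p : ℝ, 1 < p ∧ AIncExp φ p

/-- Weak equivalence `φ ∼ ψ`. The function `h ∈ L¹` is taken nonnegative: this is no restriction,
since for `Φ`-functions the inequalities at `t = 0` force `h ≥ 0` almost everywhere. -/
def WeaklyEquivalent {n : ℕ} (φ ψ : EuclideanSpace ℝ (Fin n) → ℝ≥0 → ℝ≥0∞) : Prop :=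
  ∃ (L : ℝ≥0) (h : EuclideanSpace ℝ (Fin n) → ℝ≥0),
    1 ≤ L ∧ MemLp (fun x => (h x : ℝ)) 1 volume ∧
    ∀ᵐ x ∂volume, ∀ t : ℝ≥0,
      ψ x t ≤ φ x (L * t) + h x ∧ φ x t ≤ ψ x (L * t) + h x

/-- `φ(x, ·)` extended to `[0, ∞]` by `φ(x, ∞) = ∞ = lim_{t → ∞} φ(x, t)`. -/
def extendTop {n : ℕ} (φ : EuclideanSpace ℝ (Fin n) → ℝ≥0 → ℝ≥0∞)
    (x : EuclideanSpace ℝ (Fin n)) (t : ℝ≥0∞) : ℝ≥0∞ :=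
  open Classical in if t = ⊤ then ⊤ else φ x t.toNNReal

/-- Membership `f ∈ L^φ(ℝⁿ)`: `f` is Lebesgue measurable and `∫ φ(x, c |f(x)|) dx < ∞` for some
`c > 0`. It is used for real-valued `f` and for `[0, ∞]`-valued `f`; in the second case it implies
that `f` is finite almost everywhere. -/
def MemLPhi {n : ℕ} {F : Type*} [MeasurableSpace F] [ENorm F]
    (φ : EuclideanSpace ℝ (Fin n) → ℝ≥0 → ℝ≥0∞) (f : EuclideanSpace ℝ (Fin n) → F) : Prop :=
  AEMeasurable f volume ∧
    ∃ c : ℝ≥0, 0 < c ∧ ∫⁻ x, extendTop φ x (c * ‖f x‖ₑ) ∂volume < ⊤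

/-- The Luxemburg (quasi)norm
`‖f‖_φ = inf {c > 0 : ∫ φ(x, |f(x)| / c) dx ≤ 1}`, with `inf ∅ = ∞`. -/
def normLPhi {n : ℕ} {F : Type*} [ENorm F]
    (φ : EuclideanSpace ℝ (Fin n) → ℝ≥0 → ℝ≥0∞) (f : EuclideanSpace ℝ (Fin n) → F) : ℝ≥0∞ :=
  ⨅ (c : ℝ≥0) (_ : 0 < c ∧ ∫⁻ x, extendTop φ x (‖f x‖ₑ / c) ∂volume ≤ 1), (c : ℝ≥0∞)

/-- The non-centered Hardy–Littlewood maximal function, the supremum of the averages of `|f|` over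
all open balls that contain `x`. -/
def maximalFn {n : ℕ} (f : EuclideanSpace ℝ (Fin n) → ℝ) (x : EuclideanSpace ℝ (Fin n)) : ℝ≥0∞ :=
  ⨆ (c : EuclideanSpace ℝ (Fin n)) (r : ℝ) (_ : x ∈ Metric.ball c r),
    (1 / volume (Metric.ball c r)) * ∫⁻ y in Metric.ball c r, ‖f y‖ₑ ∂volume

/-- The maximal operator is bounded from `L^φ(ℝⁿ)` to `L^φ(ℝⁿ)`. -/
def MaximalBounded {n : ℕ} (φ : EuclideanSpace ℝ (Fin n) → ℝ≥0 → ℝ≥0∞) : Prop :=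
  ∃ K : ℝ≥0, ∀ f : EuclideanSpace ℝ (Fin n) → ℝ, MemLPhi φ f →
    MemLPhi φ (maximalFn f) ∧ normLPhi φ (maximalFn f) ≤ K * normLPhi φ f

end GenOrlicz

end

/-!
# Boundedness of the maximal operator on generalized Orlicz spaces

The idea is to replace `φ` by a weakly equivalent function `ψ` for which the conditions (A0), (A1)
and (A2) collapse into one clean comparison. Let `g` be the limit function of (A2), let `t₀` be so
small that `g(t₀) < 1`, and let `D` be so large that `φ(x, D t₀) ≥ 1`. Then `ψ(x, t) = g(t)` for
`t ≤ t₀` and `ψ(x, t) = φ(x, D t)` for `t > t₀` (`glue`). Condition (A2) says that `φ` and `ψ` are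
weakly equivalent (`weaklyEquivalent_glue`), and (A0) and (A1) say that, outside a null set,
`ψ(y, κ t) ≤ ψ(x, t)` whenever `ψ(x, t) |x - y|ⁿ ≤ κ` (`distControl_glue`); for small values this
holds trivially because `ψ` does not depend on the point there. Weak equivalence preserves the
boundedness of the maximal operator `M` (`ModularBounded.of_weaklyEquivalent`), so that everything
is reduced to functions `ψ` with this property (`DistControl`).

If `M` is bounded, fix `x` and `t`, let `τ = ψ(x, t)`, and test `M` with a multiple of the indicator
of the ball `B(x, ρ)` with `τ ρⁿ = κ`. At distance `2 ^ j ρ` from `x`, the maximal function is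
about `2 ^ (-j n) t`, and the value of `ψ(x, ·)` there is at most about
`2 ^ (-j n) τ`, which is exactly the range where `ψ(y, ·)` is comparable to `ψ(x, ·)`. Each of `N`
dyadic annuli contributes at least a fixed amount to the modular, whence
`ψ(x, θ t) ≤ (θ / 2) ψ(x, t)` for a small `θ` if `N` is large
(`exists_le_half_of_modularBounded`). Iteration gives (aInc).

Conversely, let `ψ` satisfy (aInc) with exponent `p`, and let `w = ψ(·, |f|) ^ (1 / p)`. If the
modular of `f` is at most `1`, then the `p`-th power of the average of `w` over a ball `B` is at
most `1 / |B|`, so that values of this size can be compared at the points of `B`. This yields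
`ψ(x, c M f(x)) ≤ (M w(x)) ^ p` (`average_le_of_lt`), and the Hardy–Littlewood theorem in `L^p`
(`exists_lintegral_ballMax_rpow_le`) concludes (`modularBounded_of_aInc`). That (aInc) passes from
`φ` to the limit function `g`, hence to `ψ`, follows by evaluating (A2) at points where the error
term `h` is small (`exists_powInc_limit`).
-/

noncomputable section

namespace GenOrlicz

/-! ### The strong type estimate for the maximal operator -/

/-- The measure of the unit ball of `ℝⁿ`. -/
def unitVol (n : ℕ) : ℝ≥0 := (volume (Metric.ball (0 : EuclideanSpace ℝ (Fin n)) 1)).toNNReal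

theorem coe_unitVol (n : ℕ) :
    (unitVol n : ℝ≥0∞) = volume (Metric.ball (0 : EuclideanSpace ℝ (Fin n)) 1) :=
  ENNReal.coe_toNNReal measure_ball_lt_top.ne

theorem unitVol_pos (n : ℕ) : 0 < unitVol n := by
  rw [← ENNReal.coe_pos, coe_unitVol]
  exact Metric.measure_ball_pos _ _ one_pos

theorem volume_ball_eq {n : ℕ} (x : EuclideanSpace ℝ (Fin n)) {r : ℝ≥0} (hr : 0 < r) :
    volume (Metric.ball x r) = ((r ^ n * unitVol n : ℝ≥0) : ℝ≥0∞) := by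
  rw [Measure.addHaar_ball_of_pos volume x (by exact_mod_cast hr), finrank_euclideanSpace_fin,
    ENNReal.coe_mul, coe_unitVol, ← NNReal.coe_pow, ENNReal.ofReal_coe_nnreal]

/-- The non-centred maximal function of a `[0, ∞]`-valued function. -/
def ballMax {n : ℕ} (g : EuclideanSpace ℝ (Fin n) → ℝ≥0∞) (x : EuclideanSpace ℝ (Fin n)) :
    ℝ≥0∞ :=
  ⨆ (c : EuclideanSpace ℝ (Fin n)) (r : ℝ) (_ : x ∈ Metric.ball c r),
    (1 / volume (Metric.ball c r)) * ∫⁻ y in Metric.ball c r, g y ∂volume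

theorem maximalFn_eq_ballMax {n : ℕ} (f : EuclideanSpace ℝ (Fin n) → ℝ) :
    maximalFn f = ballMax (fun y => ‖f y‖ₑ) := rfl

theorem le_ballMax {n : ℕ} (g : EuclideanSpace ℝ (Fin n) → ℝ≥0∞)
    {x c : EuclideanSpace ℝ (Fin n)} {r : ℝ} (hx : x ∈ Metric.ball c r) :
    (1 / volume (Metric.ball c r)) * ∫⁻ y in Metric.ball c r, g y ∂volume ≤ ballMax g x :=
  le_iSup_of_le c <| le_iSup_of_le r <| le_iSup_of_le hx le_rfl

theorem ballMax_le_iff {n : ℕ} {g : EuclideanSpace ℝ (Fin n) → ℝ≥0∞}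
    {x : EuclideanSpace ℝ (Fin n)} {M : ℝ≥0∞} :
    ballMax g x ≤ M ↔ ∀ c r, x ∈ Metric.ball c r →
      (1 / volume (Metric.ball c r)) * ∫⁻ y in Metric.ball c r, g y ∂volume ≤ M := by
  simp [ballMax, iSup_le_iff]

theorem lt_ballMax_iff {n : ℕ} {g : EuclideanSpace ℝ (Fin n) → ℝ≥0∞}
    {x : EuclideanSpace ℝ (Fin n)} {M : ℝ≥0∞} :
    M < ballMax g x ↔ ∃ c r, x ∈ Metric.ball c r ∧
      M < (1 / volume (Metric.ball c r)) * ∫⁻ y in Metric.ball c r, g y ∂volume := by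
  simp [ballMax, lt_iSup_iff]

theorem measurable_ballMax {n : ℕ} (g : EuclideanSpace ℝ (Fin n) → ℝ≥0∞) :
    Measurable (ballMax g) := by
  refine measurable_of_Ioi fun a => IsOpen.measurableSet ?_
  rw [isOpen_iff_mem_nhds]
  intro x hx
  obtain ⟨c, r, hxc, h⟩ := lt_ballMax_iff.1 hx
  filter_upwards [Metric.isOpen_ball.mem_nhds hxc] with y hy
  exact lt_ballMax_iff.2 ⟨c, r, hy, h⟩

theorem ballMax_const_mul {n : ℕ} (a : ℝ≥0) (g : EuclideanSpace ℝ (Fin n) → ℝ≥0∞)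
    (x : EuclideanSpace ℝ (Fin n)) : ballMax (fun y => a * g y) x = a * ballMax g x := by
  simp only [ballMax, ENNReal.mul_iSup, lintegral_const_mul' _ _ ENNReal.coe_ne_top]
  simp only [mul_left_comm]

theorem ballMax_congr {n : ℕ} {g g' : EuclideanSpace ℝ (Fin n) → ℝ≥0∞} (h : g =ᵐ[volume] g') :
    ballMax g = ballMax g' := by
  funext x
  simp only [ballMax]
  congr! 6 with c r hc
  exact lintegral_congr_ae (ae_restrict_of_ae h)

/-- The maximal operator is of weak type `(1, 1)`, by the Vitali covering lemma. The radii of the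
balls over which the averages exceed `l` are bounded because `n ≥ 1`. -/
theorem mul_volume_lt_ballMax_le {n : ℕ} (hn : 1 ≤ n) (g : EuclideanSpace ℝ (Fin n) → ℝ≥0∞)
    {l : ℝ≥0} (hl : 0 < l) :
    l * volume {x | (l : ℝ≥0∞) < ballMax g x} ≤ 5 ^ n * ∫⁻ y, g y := by
  by_cases hI : ∫⁻ y, g y = ⊤
  · rw [hI, ENNReal.mul_top (by simp)]; exact le_top
  let t : Set (EuclideanSpace ℝ (Fin n) × ℝ) := {b | 0 < b.2 ∧
    (l : ℝ≥0∞) * volume (Metric.ball b.1 b.2) < ∫⁻ y in Metric.ball b.1 b.2, g y}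
  have hω := unitVol_pos n
  have hr : ∀ b ∈ t, b.2 ≤ max 1 ((∫⁻ y, g y).toNNReal / (l * unitVol n)) := by
    rintro ⟨c, r⟩ ⟨hr, hb⟩
    lift r to ℝ≥0 using hr.le
    simp only at hb hr ⊢
    replace hb := hb.le.trans (setLIntegral_le_lintegral _ _)
    rw [volume_ball_eq c (by exact_mod_cast hr), ← ENNReal.coe_toNNReal hI] at hb
    norm_cast at hb ⊢
    rw [le_max_iff, or_iff_not_imp_left, not_le]
    intro h1
    rw [le_div_iff₀ (by positivity)]
    calc r * (l * unitVol n) ≤ r ^ n * (l * unitVol n) := by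
          gcongr; exact le_self_pow₀ h1.le (by omega)
      _ = l * (r ^ n * unitVol n) := by ring
      _ ≤ _ := hb
  obtain ⟨u, hut, hu, hcov⟩ := Vitali.exists_disjoint_subfamily_covering_enlargement_ball t
    (fun b => b.1) (fun b => b.2) _ hr 5 (by norm_num)
  have hcount : u.Countable := hu.countable_of_isOpen (fun _ _ => Metric.isOpen_ball)
    (fun b hb => ⟨b.1, Metric.mem_ball_self (hut hb).1⟩)
  have hsub : {x | (l : ℝ≥0∞) < ballMax g x} ⊆ ⋃ b ∈ u, Metric.ball b.1 (5 * b.2) := by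
    intro x hx
    obtain ⟨c, r, hxc, h⟩ := lt_ballMax_iff.1 hx
    have hr : 0 < r := Metric.pos_of_mem_ball hxc
    have hb : (c, r) ∈ t := by
      refine ⟨hr, ?_⟩
      rw [one_div, mul_comm, ← div_eq_mul_inv] at h
      exact (ENNReal.lt_div_iff_mul_lt (Or.inl (Metric.measure_ball_pos _ _ hr).ne')
        (Or.inl measure_ball_lt_top.ne)).1 h
    obtain ⟨b, hbu, hb⟩ := hcov _ hb
    exact Set.mem_biUnion hbu (hb hxc)
  calc l * volume {x | (l : ℝ≥0∞) < ballMax g x}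
      ≤ l * ∑' b : u, volume (Metric.ball b.1.1 (5 * b.1.2)) := by
        gcongr
        exact (measure_mono hsub).trans (measure_biUnion_le _ hcount _)
    _ = 5 ^ n * ∑' b : u, l * volume (Metric.ball b.1.1 b.1.2) := by
        rw [← ENNReal.tsum_mul_left, ← ENNReal.tsum_mul_left]
        congr 1 with b
        have hb := (hut b.2).1
        lift b.1.2 to ℝ≥0 using hb.le with r
        rw [volume_ball_eq _ (by exact_mod_cast hb), show (5 : ℝ) * r = ((5 * r : ℝ≥0) : ℝ) by simp,
          volume_ball_eq _ (by have : 0 < r := by exact_mod_cast hb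
                               positivity)]
        push_cast
        ring
    _ ≤ 5 ^ n * ∑' b : u, ∫⁻ y in Metric.ball b.1.1 b.1.2, g y := by
        gcongr with b
        exact (hut b.2).2.le
    _ = 5 ^ n * ∫⁻ y in ⋃ b ∈ u, Metric.ball b.1 b.2, g y := by
        rw [lintegral_biUnion hcount (fun _ _ => measurableSet_ball) hu]
    _ ≤ 5 ^ n * ∫⁻ y, g y := mul_le_mul_right (setLIntegral_le_lintegral _ _) _

/-- The weak type estimate in the form that Marcinkiewicz interpolation uses: only the part of `g`
above the height `l / 2` matters. -/
theorem volume_lt_ballMax_le {n : ℕ} (hn : 1 ≤ n) {g : EuclideanSpace ℝ (Fin n) → ℝ≥0∞}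
    (hg : Measurable g) {l : ℝ≥0} (hl : 0 < l) :
    l * volume {x | (l : ℝ≥0∞) < ballMax g x} ≤
      2 * 5 ^ n * volume.withDensity g {x | (l : ℝ≥0∞) < 2 * g x} := by
  have hS : MeasurableSet {x | (l : ℝ≥0∞) < 2 * g x} :=
    measurableSet_lt measurable_const (hg.const_mul 2)
  have hle : ∀ x, ballMax g x ≤
      ballMax ({x | (l : ℝ≥0∞) < 2 * g x}.indicator g) x + (l / 2 : ℝ≥0) := by
    intro x
    rw [ballMax_le_iff]
    intro c r hx
    have hr : 0 < r := Metric.pos_of_mem_ball hx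
    calc (1 / volume (Metric.ball c r)) * ∫⁻ y in Metric.ball c r, g y
        ≤ (1 / volume (Metric.ball c r)) * ∫⁻ y in Metric.ball c r,
            ({x | (l : ℝ≥0∞) < 2 * g x}.indicator g y + (l / 2 : ℝ≥0)) := by
          gcongr with y
          by_cases hy : (l : ℝ≥0∞) < 2 * g y
          · have hy' : y ∈ {x | (l : ℝ≥0∞) < 2 * g x} := hy
            rw [Set.indicator_of_mem hy']; exact le_self_add
          · have hy' : y ∉ {x | (l : ℝ≥0∞) < 2 * g x} := hy
            rw [Set.indicator_of_notMem hy', zero_add, ENNReal.coe_div two_ne_zero,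
              ENNReal.le_div_iff_mul_le (by simp) (by simp), mul_comm]
            exact not_lt.1 hy
      _ = (1 / volume (Metric.ball c r)) * (∫⁻ y in Metric.ball c r,
            {x | (l : ℝ≥0∞) < 2 * g x}.indicator g y) + (l / 2 : ℝ≥0) := by
          rw [lintegral_add_right _ measurable_const, setLIntegral_const, mul_add]
          rw [mul_left_comm, one_div, ENNReal.inv_mul_cancel
            (Metric.measure_ball_pos _ _ hr).ne' measure_ball_lt_top.ne, mul_one]
      _ ≤ _ := add_le_add_left (le_ballMax _ hx) _
  have hsub : {x | (l : ℝ≥0∞) < ballMax g x} ⊆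
      {x | ((l / 2 : ℝ≥0) : ℝ≥0∞) < ballMax ({x | (l : ℝ≥0∞) < 2 * g x}.indicator g) x} := by
    intro x hx
    by_contra hx'
    rw [Set.mem_ofPred_eq, not_lt] at hx'
    refine absurd hx (not_lt.2 ((hle x).trans ?_))
    calc _ ≤ ((l / 2 : ℝ≥0) : ℝ≥0∞) + (l / 2 : ℝ≥0) := by gcongr
      _ = l := by rw [← ENNReal.coe_add, add_halves]
  calc (l : ℝ≥0∞) * volume {x | (l : ℝ≥0∞) < ballMax g x}
      ≤ 2 * ((l / 2 : ℝ≥0) * volume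
        {x | ((l / 2 : ℝ≥0) : ℝ≥0∞) < ballMax ({x | (l : ℝ≥0∞) < 2 * g x}.indicator g) x}) := by
        rw [← mul_assoc]
        gcongr
        rw [ENNReal.coe_div two_ne_zero, ENNReal.coe_two,
          ENNReal.mul_div_cancel (by simp) (by simp)]
    _ ≤ 2 * (5 ^ n * ∫⁻ y, {x | (l : ℝ≥0∞) < 2 * g x}.indicator g y) := by
        exact mul_le_mul_right (mul_volume_lt_ballMax_le hn _ (by positivity)) _
    _ = _ := by rw [lintegral_indicator hS, withDensity_apply _ hS, mul_assoc]

/-- The layer cake formula for a `[0, ∞]`-valued function that is finite almost everywhere. -/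
theorem lintegral_rpow_eq_lintegral_lt {α : Type*} [MeasurableSpace α] {μ : Measure α}
    {u : α → ℝ≥0∞} (hu : AEMeasurable u μ) (hfin : ∀ᵐ x ∂μ, u x ≠ ⊤) {p : ℝ} (hp : 0 < p) :
    ∫⁻ x, u x ^ p ∂μ = ENNReal.ofReal p *
      ∫⁻ t in Set.Ioi (0 : ℝ), μ {x | ENNReal.ofReal t < u x} * ENNReal.ofReal (t ^ (p - 1)) := by
  have h := lintegral_rpow_eq_lintegral_meas_lt_mul (f := fun x => (u x).toReal) μ
    (Eventually.of_forall fun _ => ENNReal.toReal_nonneg) hu.ennreal_toReal hp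
  calc ∫⁻ x, u x ^ p ∂μ = ∫⁻ x, ENNReal.ofReal ((u x).toReal ^ p) ∂μ := by
        refine lintegral_congr_ae ?_
        filter_upwards [hfin] with x hx
        rw [← ENNReal.ofReal_rpow_of_nonneg ENNReal.toReal_nonneg hp.le, ENNReal.ofReal_toReal hx]
    _ = _ := by
        rw [h]
        congr 1
        refine setLIntegral_congr_fun measurableSet_Ioi fun t ht => ?_
        congr 1
        refine measure_congr ?_
        filter_upwards [hfin] with x hx
        exact propext (ENNReal.ofReal_lt_iff_lt_toReal (le_of_lt ht) hx).symm

theorem lintegral_rpow_le_lintegral_lt {α : Type*} [MeasurableSpace α] {μ : Measure α}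
    {u : α → ℝ≥0∞} (hu : Measurable u) {p : ℝ} (hp : 0 < p) :
    ∫⁻ x, u x ^ p ∂μ ≤ ENNReal.ofReal p *
      ∫⁻ t in Set.Ioi (0 : ℝ), μ {x | ENNReal.ofReal t < u x} * ENNReal.ofReal (t ^ (p - 1)) := by
  have hsup : ∀ x, u x ^ p = ⨆ N : ℕ, (min (u x) N) ^ p := by
    intro x
    refine le_antisymm ?_ (iSup_le fun N => ENNReal.rpow_le_rpow (min_le_left _ _) hp.le)
    by_cases hx : u x = ⊤
    · rw [hx, ENNReal.top_rpow_of_pos hp]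
      refine le_of_eq (Eq.symm ?_)
      refine ENNReal.eq_top_of_forall_nnreal_le fun r => ?_
      obtain ⟨N, hN⟩ := exists_nat_ge (r ^ (1 / p))
      refine le_iSup_of_le N ?_
      rw [min_eq_right le_top, ← ENNReal.rpow_inv_le_iff hp, inv_eq_one_div,
        ← ENNReal.coe_rpow_of_nonneg _ (by positivity)]
      exact_mod_cast hN
    · obtain ⟨N, hN⟩ := ENNReal.exists_nat_gt hx
      exact le_iSup_of_le N (by rw [min_eq_left hN.le])
  have hmono : Monotone fun (N : ℕ) x => (min (u x) (N : ℝ≥0∞)) ^ p := by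
    intro N N' h x
    exact ENNReal.rpow_le_rpow (min_le_min_left _ (by exact_mod_cast h)) hp.le
  simp_rw [hsup]
  rw [lintegral_iSup (fun N => (hu.min measurable_const).pow_const p) hmono]
  refine iSup_le fun N => ?_
  rw [lintegral_rpow_eq_lintegral_lt (hu.min measurable_const).aemeasurable
    (Eventually.of_forall fun x => ((min_le_right _ _).trans_lt (ENNReal.natCast_lt_top N)).ne) hp]
  gcongr
  exact min_le_left _ _

/-- The Hardy–Littlewood maximal theorem: the maximal operator is bounded on `L^p` for `p > 1`. -/
theorem exists_lintegral_ballMax_rpow_le {n : ℕ} (hn : 1 ≤ n) {p : ℝ} (hp : 1 < p) :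
    ∃ C : ℝ≥0, ∀ g : EuclideanSpace ℝ (Fin n) → ℝ≥0∞, AEMeasurable g volume →
      ∫⁻ x, ballMax g x ^ p ≤ C * ∫⁻ x, g x ^ p := by
  have hp0 : 0 < p := by linarith
  have hp1 : 0 < p - 1 := by linarith
  have hq : ENNReal.ofReal (p - 1) ≠ 0 := by simpa using hp
  -- the constant produced by the layer cake formulas for the exponents `p` and `p - 1`
  let C : ℝ≥0∞ := ENNReal.ofReal p * (2 * 5 ^ n) * (ENNReal.ofReal (p - 1))⁻¹ * 2 ^ (p - 1)
  have hC : C ≠ ⊤ := by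
    refine ENNReal.mul_ne_top
      (ENNReal.mul_ne_top (ENNReal.mul_ne_top ENNReal.ofReal_ne_top ?_) ?_) ?_
    · exact ENNReal.mul_ne_top (by simp) (by finiteness)
    · simpa using hp
    · exact ENNReal.rpow_ne_top_of_nonneg hp1.le (by simp)
  refine ⟨C.toNNReal, fun g hg => ?_⟩
  rw [ENNReal.coe_toNNReal hC]
  wlog hgm : Measurable g generalizing g
  · have := this (hg.mk g) hg.measurable_mk.aemeasurable hg.measurable_mk
    rw [ballMax_congr hg.ae_eq_mk]
    refine this.trans_eq ?_
    congr 1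
    refine lintegral_congr_ae ?_
    filter_upwards [hg.ae_eq_mk] with x hx
    rw [hx]
  by_cases hI : ∫⁻ x, g x ^ p = ⊤
  · have : C ≠ 0 := by
      have h1 : ENNReal.ofReal p ≠ 0 := by simpa using hp0
      have h2 : (2 : ℝ≥0∞) ^ (p - 1) ≠ 0 := by simp
      have h3 : (2 * 5 ^ n : ℝ≥0∞) ≠ 0 := by simp
      have h4 : (ENNReal.ofReal (p - 1))⁻¹ ≠ 0 := by simp
      exact mul_ne_zero (mul_ne_zero (mul_ne_zero h1 h3) h4) h2
    rw [hI, ENNReal.mul_top this]; exact le_top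
  have hfin : ∀ᵐ x, g x ≠ ⊤ := by
    filter_upwards [ae_lt_top (hgm.pow_const p) hI] with x hx h
    simp [h, hp0] at hx
  have hfin2 : ∀ᵐ x ∂volume.withDensity g, 2 * g x ≠ ⊤ := by
    refine (withDensity_absolutelyContinuous volume g).ae_le ?_
    filter_upwards [hfin] with x hx
    exact ENNReal.mul_ne_top (by simp) hx
  have key := lintegral_rpow_eq_lintegral_lt (μ := volume.withDensity g)
    (hgm.const_mul 2).aemeasurable hfin2 hp1
  calc ∫⁻ x, ballMax g x ^ p
      ≤ ENNReal.ofReal p * ∫⁻ t in Set.Ioi (0 : ℝ),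
        volume {x | ENNReal.ofReal t < ballMax g x} * ENNReal.ofReal (t ^ (p - 1)) :=
        lintegral_rpow_le_lintegral_lt (measurable_ballMax g) hp0
    _ ≤ ENNReal.ofReal p * ∫⁻ t in Set.Ioi (0 : ℝ), 2 * 5 ^ n *
        (volume.withDensity g {x | ENNReal.ofReal t < 2 * g x} *
          ENNReal.ofReal (t ^ (p - 1 - 1))) := by
        gcongr ENNReal.ofReal p * ?_
        refine setLIntegral_mono' measurableSet_Ioi fun t ht => ?_
        have ht : 0 < t := ht
        have h := volume_lt_ballMax_le hn hgm (l := t.toNNReal) (by simpa using ht)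
        have e : ENNReal.ofReal (t ^ (p - 1)) =
            ENNReal.ofReal t * ENNReal.ofReal (t ^ (p - 1 - 1)) := by
          rw [← ENNReal.ofReal_mul ht.le, ← Real.rpow_one_add' ht.le (by linarith)]
          congr 2; ring
        rw [e, ← mul_assoc, ← mul_assoc, mul_comm (volume _)]
        exact mul_le_mul_left h _
    _ = ENNReal.ofReal p * (2 * 5 ^ n) * (ENNReal.ofReal (p - 1))⁻¹ *
        ∫⁻ x, (2 * g x) ^ (p - 1) ∂(volume.withDensity g) := by
        rw [key, lintegral_const_mul' _ _ (ENNReal.mul_ne_top (by simp) (by finiteness)),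
          ← mul_assoc, mul_assoc _ (ENNReal.ofReal (p - 1))⁻¹, ← mul_assoc (_)⁻¹,
          ENNReal.inv_mul_cancel hq ENNReal.ofReal_ne_top, one_mul]
    _ = C * ∫⁻ x, g x ^ p := by
        rw [lintegral_withDensity_eq_lintegral_mul _ hgm ((hgm.const_mul 2).pow_const _)]
        simp only [C, mul_assoc]
        rw [← lintegral_const_mul' _ _ (ENNReal.rpow_ne_top_of_nonneg hp1.le (by simp))]
        congr 4
        refine lintegral_congr fun x => ?_
        simp only [Pi.mul_apply]
        rw [ENNReal.mul_rpow_of_nonneg _ _ hp1.le, mul_left_comm]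
        congr 1
        conv_rhs => rw [show p = 1 + (p - 1) by ring,
          ENNReal.rpow_add_of_nonneg _ _ zero_le_one hp1.le,
          ENNReal.rpow_one]

/-! ### Almost increasing quotients -/

/-- `F(t) / t ^ p` is almost increasing with constant `a`, in the form
`F(ct) ≤ a c ^ p F(t)` for `c ≤ 1`, which involves no division. -/
def PowInc (p : ℝ) (a : ℝ≥0) (F : ℝ≥0 → ℝ≥0∞) : Prop :=
  ∀ c t : ℝ≥0, c ≤ 1 → F (c * t) ≤ (a * c ^ p : ℝ≥0) * F t

theorem powInc_iff {p : ℝ} (hp : 0 < p) {a : ℝ≥0} (ha : 1 ≤ a) {F : ℝ≥0 → ℝ≥0∞} (h0 : F 0 = 0) :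
    PowInc p a F ↔ ∀ t s : ℝ≥0, 0 < t → t < s →
      F t / (t : ℝ≥0∞) ^ p ≤ a * (F s / (s : ℝ≥0∞) ^ p) := by
  constructor
  · intro h t s ht hts
    have hs : 0 < s := ht.trans hts
    have := h (t / s) s (div_le_one_of_le₀ hts.le zero_le)
    rw [div_mul_cancel₀ _ hs.ne'] at this
    have h1 : (t : ℝ≥0∞) ^ p ≠ 0 := by simp [ht.ne', hp]
    have h2 : (t : ℝ≥0∞) ^ p ≠ ⊤ := by simp [hp.le]
    rw [ENNReal.div_le_iff h1 h2]
    refine this.trans_eq ?_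
    rw [NNReal.div_rpow, ENNReal.coe_mul, ENNReal.coe_div (NNReal.rpow_pos hs).ne',
      ENNReal.coe_rpow_of_nonneg _ hp.le, ENNReal.coe_rpow_of_nonneg _ hp.le,
      div_eq_mul_inv, div_eq_mul_inv]
    ring
  · intro h c t hc
    rcases eq_or_ne c 0 with rfl | hc0
    · simp [h0]
    rcases eq_or_ne t 0 with rfl | ht0
    · simp [h0]
    rcases hc.lt_or_eq with hc1 | rfl
    · have hct : 0 < c * t := by positivity
      have := h (c * t) t hct (mul_lt_of_lt_one_left (pos_iff_ne_zero.2 ht0) hc1)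
      have h1 : ((c * t : ℝ≥0) : ℝ≥0∞) ^ p ≠ 0 := by simp [hc0, ht0, hp, hp.le]
      have h2 : ((c * t : ℝ≥0) : ℝ≥0∞) ^ p ≠ ⊤ := by
        rw [← ENNReal.coe_rpow_of_nonneg _ hp.le]; exact ENNReal.coe_ne_top
      have h3 : (t : ℝ≥0∞) ^ p ≠ 0 := by simp [ht0, hp]
      have h4 : (t : ℝ≥0∞) ^ p ≠ ⊤ := by simp [hp.le]
      rw [ENNReal.div_le_iff h1 h2] at this
      refine this.trans_eq ?_
      rw [ENNReal.coe_mul, ENNReal.coe_mul, ENNReal.mul_rpow_of_nonneg _ _ hp.le,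
        ENNReal.coe_rpow_of_nonneg _ hp.le, div_eq_mul_inv]
      calc _ = a * c ^ p * F t * ((t : ℝ≥0∞) ^ p * ((t : ℝ≥0∞) ^ p)⁻¹) := by ring
        _ = _ := by rw [ENNReal.mul_inv_cancel h3 h4, mul_one]
    · rw [one_mul, NNReal.one_rpow, mul_one]
      exact le_mul_of_one_le_left zero_le (by exact_mod_cast ha)

theorem PowInc.map_zero {p : ℝ} (hp : 0 < p) {a : ℝ≥0} {F : ℝ≥0 → ℝ≥0∞} (h : PowInc p a F) :
    F 0 = 0 := by
  simpa [hp.ne'] using h 0 0 zero_le_one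

theorem PowInc.le_mul {L : ℝ≥0} {F : ℝ≥0 → ℝ≥0∞} (h : PowInc 1 L F) {c t : ℝ≥0} (hc : c ≤ 1) :
    F (c * t) ≤ (L * c : ℝ≥0) * F t := by
  simpa using h c t hc

/-- The estimate `F(s) / s ≤ L F(t) / t` for `0 < s ≤ t`, solved for `F(t)`. -/
theorem PowInc.mul_le {L : ℝ≥0} {F : ℝ≥0 → ℝ≥0∞} (h : PowInc 1 L F) {c t : ℝ≥0} (hc : 1 ≤ c) :
    c * F t ≤ L * F (c * t) := by
  have hc0 : c ≠ 0 := (zero_lt_one.trans_le hc).ne'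
  have := h.le_mul (c := c⁻¹) (t := c * t) (inv_le_one_of_one_le₀ hc)
  rw [inv_mul_cancel_left₀ hc0] at this
  calc c * F t ≤ c * ((L * c⁻¹ : ℝ≥0) * F (c * t)) := by gcongr
    _ = ((c * c⁻¹ : ℝ≥0) : ℝ≥0∞) * (L * F (c * t)) := by push_cast; ring
    _ = _ := by rw [mul_inv_cancel₀ hc0, ENNReal.coe_one, one_mul]

theorem IsWeakPhi.exists_powInc {n : ℕ} {φ : EuclideanSpace ℝ (Fin n) → ℝ≥0 → ℝ≥0∞}
    (hφ : IsWeakPhi φ) : ∃ L : ℝ≥0, 1 ≤ L ∧ ∀ x, PowInc 1 L (φ x) := by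
  obtain ⟨L, hL, h⟩ := hφ.almost_increasing
  refine ⟨L, hL, fun x => (powInc_iff one_pos hL (hφ.map_zero x)).2 ?_⟩
  simpa using h x

theorem aIncExp_iff {n : ℕ} {φ : EuclideanSpace ℝ (Fin n) → ℝ≥0 → ℝ≥0∞} (hφ : IsWeakPhi φ)
    {p : ℝ} (hp : 0 < p) :
    AIncExp φ p ↔ ∃ a : ℝ≥0, 1 ≤ a ∧ ∀ᵐ x, PowInc p a (φ x) := by
  refine exists_congr fun a => and_congr_right fun ha => ?_
  simp only [powInc_iff hp ha (hφ.map_zero _)]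

/-! ### The modular and bounds of the maximal operator -/

section extendTop

variable {n : ℕ} {φ ψ : EuclideanSpace ℝ (Fin n) → ℝ≥0 → ℝ≥0∞}

@[simp] theorem extendTop_coe (x : EuclideanSpace ℝ (Fin n)) (t : ℝ≥0) :
    extendTop φ x t = φ x t := by
  simp [extendTop]

@[simp] theorem extendTop_top (x : EuclideanSpace ℝ (Fin n)) : extendTop φ x ⊤ = ⊤ := by
  simp [extendTop]

theorem IsWeakPhi.extendTop_mono (hφ : IsWeakPhi φ) (x : EuclideanSpace ℝ (Fin n)) :
    Monotone (extendTop φ x) := by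
  intro s t hst
  induction t with
  | top => simp
  | coe t =>
    lift s to ℝ≥0 using (hst.trans_lt ENNReal.coe_lt_top).ne
    simpa using hφ.monotone x (by exact_mod_cast hst)

theorem extendTop_mul_le {x : EuclideanSpace ℝ (Fin n)} {L : ℝ≥0} (hL : 1 ≤ L)
    (h : PowInc 1 L (φ x)) {c : ℝ≥0} (hc : c ≤ 1) (t : ℝ≥0∞) :
    extendTop φ x (c * t) ≤ (L * c : ℝ≥0) * extendTop φ x t := by
  induction t with
  | top =>
    rcases eq_or_ne c 0 with rfl | hc0
    · have := extendTop_coe (φ := φ) x 0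
      simp_all [h.map_zero one_pos]
    · have : ((L * c : ℝ≥0) : ℝ≥0∞) ≠ 0 :=
        ENNReal.coe_ne_zero.2 (mul_ne_zero (zero_lt_one.trans_le hL).ne' hc0)
      rw [extendTop_top (φ := φ), ENNReal.mul_top this]
      exact le_top
  | coe t =>
    rw [← ENNReal.coe_mul, extendTop_coe, extendTop_coe]
    exact h.le_mul hc

/-- The modular is at most `1` after division by a constant that depends only on its size. -/
theorem lintegral_extendTop_div_le_one {L : ℝ≥0} (hL : 1 ≤ L) (h : ∀ x, PowInc 1 L (φ x))
    {u : EuclideanSpace ℝ (Fin n) → ℝ≥0∞} {H C : ℝ≥0} (hu : ∫⁻ x, extendTop φ x (u x) ≤ H)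
    (hC : 1 ≤ C) (hHC : L * H ≤ C) :
    ∫⁻ x, extendTop φ x (u x / C) ≤ 1 := by
  have hC0 : 0 < C := zero_lt_one.trans_le hC
  calc ∫⁻ x, extendTop φ x (u x / C)
      ≤ ∫⁻ x, (L * C⁻¹ : ℝ≥0) * extendTop φ x (u x) := by
        refine lintegral_mono fun x => ?_
        rw [div_eq_mul_inv, mul_comm, ← ENNReal.coe_inv hC0.ne']
        exact extendTop_mul_le hL (h x) (inv_le_one_of_one_le₀ hC) _
    _ = (L * C⁻¹ : ℝ≥0) * ∫⁻ x, extendTop φ x (u x) :=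
        lintegral_const_mul' _ _ ENNReal.coe_ne_top
    _ ≤ (L * C⁻¹ : ℝ≥0) * H := by gcongr
    _ ≤ 1 := by
        norm_cast
        rw [mul_right_comm, ← div_eq_mul_inv]
        exact div_le_one_of_le₀ hHC zero_le

theorem enorm_div_coe (a : ℝ) {C : ℝ≥0} (hC : 0 < C) : ‖a / C‖ₑ = ‖a‖ₑ / C := by
  rw [div_eq_mul_inv, enorm_mul, enorm_inv (by positivity), ← div_eq_mul_inv]
  congr
  simp [enorm_eq_nnnorm]

theorem maximalFn_div (f : EuclideanSpace ℝ (Fin n) → ℝ) {C : ℝ≥0} (hC : 0 < C)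
    (x : EuclideanSpace ℝ (Fin n)) : maximalFn (fun y => f y / C) x = maximalFn f x / C := by
  simp only [maximalFn_eq_ballMax, enorm_div_coe _ hC]
  rw [div_eq_mul_inv, ← ENNReal.coe_inv hC.ne', mul_comm, ← ballMax_const_mul]
  simp only [div_eq_mul_inv, ← ENNReal.coe_inv hC.ne', mul_comm]

/-- Boundedness of the maximal operator in terms of the modular: the unit ball of the modular is
mapped into a multiple of itself. -/
def ModularBounded (φ : EuclideanSpace ℝ (Fin n) → ℝ≥0 → ℝ≥0∞) : Prop :=
  ∃ K : ℝ≥0, 0 < K ∧ ∀ f : EuclideanSpace ℝ (Fin n) → ℝ, AEMeasurable f volume →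
    ∫⁻ x, extendTop φ x ‖f x‖ₑ ≤ 1 → ∫⁻ x, extendTop φ x (maximalFn f x / K) ≤ 1

theorem maximalBounded_iff_modularBounded (hφ : IsWeakPhi φ) :
    MaximalBounded φ ↔ ModularBounded φ := by
  obtain ⟨L, hL, hLφ⟩ := hφ.exists_powInc
  constructor
  · rintro ⟨K, hK⟩
    -- `K + 1` rather than `K`, as the infimum in the norm need not be attained
    refine ⟨K + 1, by positivity, fun f hf hf1 => ?_⟩
    have hmem : MemLPhi φ f :=
      ⟨hf, 1, one_pos, by simpa using hf1.trans_lt ENNReal.one_lt_top⟩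
    have hnorm : normLPhi φ f ≤ 1 :=
      iInf₂_le_of_le (1 : ℝ≥0) ⟨one_pos, by simpa using hf1⟩ (by simp)
    have h : normLPhi φ (maximalFn f) < (K + 1 : ℝ≥0) := by
      refine ((hK f hmem).2.trans (mul_le_of_le_one_right' hnorm)).trans_lt ?_
      exact_mod_cast lt_add_one K
    simp only [normLPhi, iInf_lt_iff] at h
    obtain ⟨c, ⟨hc, hc1⟩, hcK⟩ := h
    refine le_trans (lintegral_mono fun x => hφ.extendTop_mono x ?_) hc1
    gcongr
    simp
  · rintro ⟨K, hK0, hK⟩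
    have key : ∀ f : EuclideanSpace ℝ (Fin n) → ℝ, AEMeasurable f volume → ∀ c : ℝ≥0, 0 < c →
        ∫⁻ x, extendTop φ x (‖f x‖ₑ / c) ≤ 1 →
        ∫⁻ x, extendTop φ x (‖maximalFn f x‖ₑ / (K * c : ℝ≥0)) ≤ 1 := by
      intro f hf c hc h
      have := hK (fun y => f y / c) (hf.div_const _) (by simpa only [enorm_div_coe _ hc] using h)
      simp only [maximalFn_div f hc] at this
      refine le_of_eq_of_le (lintegral_congr fun x => ?_) this
      congr 1
      rw [ENNReal.coe_mul, enorm_eq_self, div_eq_mul_inv, div_eq_mul_inv, div_eq_mul_inv,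
        ENNReal.mul_inv (by simp) (by simp), mul_comm (K : ℝ≥0∞)⁻¹, mul_assoc]
    refine ⟨K, fun f hf => ⟨⟨(measurable_ballMax _).aemeasurable, ?_⟩, ?_⟩⟩
    · obtain ⟨hfm, c, hc, hfc⟩ := hf
      set H := (∫⁻ x, extendTop φ x (c * ‖f x‖ₑ)).toNNReal with hH
      have hC : 0 < max 1 (L * H) := by positivity
      have h := lintegral_extendTop_div_le_one hL hLφ (u := fun x => c * ‖f x‖ₑ) (H := H)
        (C := max 1 (L * H)) (by rw [hH, ENNReal.coe_toNNReal hfc.ne]) (le_max_left _ _)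
        (le_max_right _ _)
      have h' := key f hfm (max 1 (L * H) / c) (by positivity) (by
        refine le_of_eq_of_le (lintegral_congr fun x => ?_) h
        congr 1
        rw [ENNReal.coe_div hc.ne', div_eq_mul_inv, div_eq_mul_inv, div_eq_mul_inv,
          ENNReal.mul_inv (by simp) (by simp), inv_inv]
        ring)
      refine ⟨(K * (max 1 (L * H) / c))⁻¹, by positivity, ?_⟩
      refine lt_of_le_of_lt (le_of_eq_of_le (lintegral_congr fun x => ?_) h') ENNReal.one_lt_top
      rw [ENNReal.coe_inv (by positivity), mul_comm, ← div_eq_mul_inv]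
    · have hK0' : (K : ℝ≥0∞) ≠ 0 := by simpa using hK0.ne'
      rw [← ENNReal.div_le_iff' hK0' ENNReal.coe_ne_top]
      refine le_iInf₂ fun c hc => ?_
      rw [ENNReal.div_le_iff' hK0' ENNReal.coe_ne_top, ← ENNReal.coe_mul]
      exact iInf₂_le_of_le (K * c) ⟨mul_pos hK0 hc.1, key f hf.1 c hc.1 hc.2⟩ le_rfl

theorem WeaklyEquivalent.symm (h : WeaklyEquivalent φ ψ) : WeaklyEquivalent ψ φ := by
  obtain ⟨L, h, hL, hh, hall⟩ := h
  exact ⟨L, h, hL, hh, hall.mono fun x hx t => ⟨(hx t).2, (hx t).1⟩⟩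

theorem lintegral_coe_lt_top {h : EuclideanSpace ℝ (Fin n) → ℝ≥0}
    (hh : MemLp (fun x => (h x : ℝ)) 1 volume) : ∫⁻ x, (h x : ℝ≥0∞) < ⊤ := by
  have := hh.eLpNorm_lt_top
  rw [eLpNorm_one_eq_lintegral_enorm] at this
  simpa [enorm_eq_nnnorm] using this

theorem aemeasurable_coe {h : EuclideanSpace ℝ (Fin n) → ℝ≥0}
    (hh : MemLp (fun x => (h x : ℝ)) 1 volume) : AEMeasurable (fun x => (h x : ℝ≥0∞)) volume := by
  have := hh.aestronglyMeasurable.aemeasurable.ennreal_ofReal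
  simpa using this

theorem ModularBounded.of_weaklyEquivalent (hφ : IsWeakPhi φ) (hψ : IsWeakPhi ψ)
    (hφψ : WeaklyEquivalent φ ψ) (hb : ModularBounded φ) : ModularBounded ψ := by
  obtain ⟨L₁, hL₁, hLφ⟩ := hφ.exists_powInc
  obtain ⟨L₂, hL₂, hLψ⟩ := hψ.exists_powInc
  obtain ⟨L, h, hL, hh, hall⟩ := hφψ
  obtain ⟨K, hK, hb⟩ := hb
  have hL0 : 0 < L := zero_lt_one.trans_le hL
  set H := (∫⁻ x, (h x : ℝ≥0∞)).toNNReal with hH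
  have hHeq : (H : ℝ≥0∞) = ∫⁻ x, (h x : ℝ≥0∞) :=
    ENNReal.coe_toNNReal (lintegral_coe_lt_top hh).ne
  -- passing from one modular to the other costs a dilation by `L` and the integral of `h`
  have step : ∀ (φ₁ φ₂ : EuclideanSpace ℝ (Fin n) → ℝ≥0 → ℝ≥0∞),
      (∀ᵐ x, ∀ t, φ₂ x t ≤ φ₁ x (L * t) + h x) → ∀ u : EuclideanSpace ℝ (Fin n) → ℝ≥0∞,
      ∫⁻ x, extendTop φ₁ x (u x) ≤ 1 →
        ∫⁻ x, extendTop φ₂ x (u x / L) ≤ (1 + H : ℝ≥0) := by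
    intro φ₁ φ₂ h12 u hu
    calc ∫⁻ x, extendTop φ₂ x (u x / L) ≤ ∫⁻ x, (extendTop φ₁ x (u x) + h x) := by
          refine lintegral_mono_ae ?_
          filter_upwards [h12] with x hx
          induction u x with
          | top => simp
          | coe t =>
            have := hx (t / L)
            rw [mul_div_cancel₀ _ hL0.ne'] at this
            rwa [← ENNReal.coe_div hL0.ne', extendTop_coe, extendTop_coe]
      _ = (∫⁻ x, extendTop φ₁ x (u x)) + H := by
          rw [lintegral_add_right' _ (aemeasurable_coe hh), hHeq]
      _ ≤ _ := by push_cast; gcongr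
  have h12 := hall.mono fun x hx t => (hx t).1
  have h21 := hall.mono fun x hx t => (hx t).2
  let C₁ := max 1 (L₁ * (1 + H))
  let C₂ := max 1 (L₂ * (1 + H))
  have hC₁ : 0 < C₁ := by positivity
  have hC₂ : 0 < C₂ := by positivity
  refine ⟨L * C₁ * K * L * C₂, by positivity, fun f hf hf1 => ?_⟩
  have e1 := lintegral_extendTop_div_le_one hL₁ hLφ (step ψ φ h21 _ hf1) (le_max_left 1 _)
    (le_max_right _ _)
  have e2 := hb (fun y => f y / L / C₁) ((hf.div_const _).div_const _) (by
    simpa only [enorm_div_coe _ hL0, enorm_div_coe _ hC₁] using e1)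
  simp only [maximalFn_div _ hL0, maximalFn_div _ hC₁] at e2
  have e3 := lintegral_extendTop_div_le_one hL₂ hLψ (step φ ψ h12 _ e2) (le_max_left 1 _)
    (le_max_right _ _)
  refine le_of_eq_of_le (lintegral_congr fun x => ?_) e3
  congr 1
  simp only [div_eq_mul_inv, ENNReal.coe_mul]
  have hne : ∀ a : ℝ≥0, 0 < a → (a : ℝ≥0∞)⁻¹ = ((a⁻¹ : ℝ≥0) : ℝ≥0∞) := fun a ha =>
    (ENNReal.coe_inv ha.ne').symm
  simp only [← ENNReal.coe_mul]
  rw [hne _ hL0, hne _ hC₁, hne _ hK, hne _ (by positivity), hne _ (by positivity)]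
  simp only [mul_assoc, ← ENNReal.coe_mul]
  congr 2
  simp only [mul_inv]
  rfl

end extendTop

/-! ### The local condition in terms of distances -/

section distance

variable {n : ℕ} {φ : EuclideanSpace ℝ (Fin n) → ℝ≥0 → ℝ≥0∞} {x : EuclideanSpace ℝ (Fin n)}

theorem genInv_le {t : ℝ≥0∞} {τ : ℝ≥0} (h : t ≤ φ x τ) : genInv φ x t ≤ τ :=
  iInf₂_le τ h

theorem le_genInv (hmono : Monotone (φ x)) {t : ℝ≥0∞} {τ : ℝ≥0} (h : φ x τ < t) :
    (τ : ℝ≥0∞) ≤ genInv φ x t := by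
  refine le_iInf₂ fun σ hσ => ?_
  have : τ ≤ σ := by
    by_contra hlt
    exact absurd (hσ.trans (hmono (not_le.1 hlt).le)) (not_le.2 h)
  exact_mod_cast this

theorem lt_of_lt_genInv {t : ℝ≥0∞} {τ : ℝ≥0} (h : (τ : ℝ≥0∞) < genInv φ x t) : φ x τ < t :=
  not_le.1 fun h' => absurd (genInv_le h') (not_le.2 h)

theorem exists_lt_of_genInv_lt {t s : ℝ≥0∞} (h : genInv φ x t < s) :
    ∃ τ : ℝ≥0, (τ : ℝ≥0∞) < s ∧ t ≤ φ x τ := by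
  simp only [genInv, iInf_lt_iff] at h
  obtain ⟨τ, hτ, hs⟩ := h
  exact ⟨τ, hs, hτ⟩

/-- Condition (A1) on a fixed ball and at a fixed argument. The essential supremum over the ball
separates the two points, so that no measurability on the product space is needed. -/
theorem ae_le_essSup_and_essSup_le (hmono : ∀ x, Monotone (φ x)) (hz : ∀ x, φ x 0 = 0)
    {B : Set (EuclideanSpace ℝ (Fin n))} (hB : MeasurableSet B) (hB1 : volume B ≤ 1)
    (hB0 : volume B ≠ 0) {β : ℝ≥0} (hβ : 0 < β)
    (h : ∀ᵐ x ∂(volume.restrict B), ∀ᵐ y ∂(volume.restrict B), ∀ t : ℝ≥0∞, 1 ≤ t →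
      t ≤ 1 / volume B → β * genInv φ x t ≤ genInv φ y t) (t : ℝ≥0) :
    ∀ᵐ x, x ∈ B → φ x (β / 2 * t) ≤ essSup (fun y => φ y (β / 2 * t)) (volume.restrict B) ∧
      (φ x t * volume B < 1 →
        essSup (fun y => φ y (β / 2 * t)) (volume.restrict B) ≤ max 1 (φ x t)) := by
  rw [← ae_restrict_iff' hB]
  filter_upwards [h, ENNReal.ae_le_essSup (μ := volume.restrict B) fun y => φ y (β / 2 * t)]
    with x hx hxS
  refine ⟨hxS, fun hlt => ?_⟩
  have hlt' : φ x t < 1 / volume B := by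
    rw [ENNReal.lt_div_iff_mul_lt (Or.inl hB0) (Or.inl (hB1.trans_lt ENNReal.one_lt_top).ne)]
    exact hlt
  refine essSup_le_of_ae_le _ ?_
  filter_upwards [hx] with y hy
  rcases eq_or_ne t 0 with rfl | ht
  · simp [hz]
  by_contra hcon
  rw [not_le, max_lt_iff] at hcon
  -- a level between `max 1 (φ x t)` and both `φ y (β / 2 * t)` and `1 / |B|`
  set τ := min (φ y (β / 2 * t)) (1 / volume B) with hτ
  have h1 : 1 ≤ τ := le_min hcon.1.le (by simpa using hB1)
  have h2 := hy τ h1 (min_le_right _ _)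
  have h3 : (t : ℝ≥0∞) ≤ genInv φ x τ := le_genInv (hmono x) (lt_min hcon.2 hlt')
  have h4 : genInv φ y τ ≤ (β / 2 * t : ℝ≥0) := genInv_le (min_le_left _ _)
  have h5 : ((β * t : ℝ≥0) : ℝ≥0∞) ≤ (β / 2 * t : ℝ≥0) := by
    rw [ENNReal.coe_mul]
    exact (mul_le_mul_right h3 _).trans (h2.trans h4)
  have h6 : β / 2 * t < β * t := by
    have := half_lt_self hβ
    gcongr
  exact absurd (ENNReal.coe_le_coe.1 h5) (not_le.2 h6)

/-- Conditions (A0) and (A1) imply a comparison of `φ x` and `φ y` that involves only the distance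
of the points. Countably many balls and countably many arguments suffice, whence a single
exceptional null set. -/
theorem exists_dist_control (hφ : IsWeakPhi φ) (h0 : A0 φ) (h1 : A1 φ) :
    ∃ κ : ℝ≥0, 0 < κ ∧ κ ≤ 1 ∧ ∃ G : Set (EuclideanSpace ℝ (Fin n)), (∀ᵐ x, x ∈ G) ∧
      ∀ x ∈ G, ∀ y ∈ G, ∀ t : ℝ≥0, φ x t * (nndist x y ^ n : ℝ≥0) ≤ κ →
        φ y (κ * t) ≤ max 1 (φ x t) := by
  obtain ⟨β₀, hβ₀, hβ₀1, hA0⟩ := h0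
  obtain ⟨β, hβ, hβ1, hA1⟩ := h1
  have h2 : (0 : ℝ≥0) < 2 := two_pos
  let B : ℕ → ℤ → Set (EuclideanSpace ℝ (Fin n)) := fun i k =>
    Metric.ball (TopologicalSpace.denseSeq _ i) (((2 : ℝ≥0) ^ k : ℝ≥0) : ℝ)
  have hBvol : ∀ i k, volume (B i k) = (((2 : ℝ≥0) ^ k) ^ n * unitVol n : ℝ≥0) := fun i k =>
    volume_ball_eq _ (zpow_pos h2 k)
  have hω := unitVol_pos n
  set κ : ℝ≥0 := min (min (β / 4) (β₀ * β₀ / 2)) (1 / (2 * 4 ^ n * unitVol n)) with hκ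
  have hκ0 : 0 < κ := by positivity
  have hκβ : κ ≤ β / 4 := (min_le_left _ _).trans (min_le_left _ _)
  have hκβ₀ : κ ≤ β₀ * β₀ / 2 := (min_le_left _ _).trans (min_le_right _ _)
  have hκω : κ * (4 ^ n * unitVol n) < 1 := by
    calc κ * (4 ^ n * unitVol n) ≤ 1 / (2 * 4 ^ n * unitVol n) * (4 ^ n * unitVol n) := by
          gcongr; exact min_le_right _ _
      _ = 1 / 2 := by field_simp
      _ < 1 := NNReal.half_lt_self one_ne_zero |>.trans_eq rfl
  have hκ1 : κ ≤ 1 := by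
    refine hκβ.trans ?_
    rw [div_le_iff₀ (by norm_num)]
    exact hβ1.le.trans (by norm_num)
  have hall : ∀ᵐ x, ∀ i k, volume (B i k) ≤ 1 → ∀ j : ℤ, x ∈ B i k →
      φ x (β / 2 * 2 ^ j) ≤ essSup (fun y => φ y (β / 2 * 2 ^ j)) (volume.restrict (B i k)) ∧
      (φ x (2 ^ j) * volume (B i k) < 1 →
        essSup (fun y => φ y (β / 2 * 2 ^ j)) (volume.restrict (B i k)) ≤
          max 1 (φ x (2 ^ j))) := by
    simp only [ae_all_iff]
    intro i k hik j
    have hr : (0 : ℝ) < (((2 : ℝ≥0) ^ k : ℝ≥0) : ℝ) := by exact_mod_cast zpow_pos h2 k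
    exact ae_le_essSup_and_essSup_le hφ.monotone hφ.map_zero measurableSet_ball hik
      (Metric.measure_ball_pos _ _ hr).ne' hβ (hA1 _ _ hr hik) _
  refine ⟨κ, hκ0, hκ1, {x | ((β₀ : ℝ≥0∞) ≤ genInv φ x 1 ∧ genInv φ x 1 ≤ 1 / (β₀ : ℝ≥0∞)) ∧
    ∀ i k, volume (B i k) ≤ 1 → ∀ j : ℤ, x ∈ B i k →
      φ x (β / 2 * 2 ^ j) ≤ essSup (fun y => φ y (β / 2 * 2 ^ j)) (volume.restrict (B i k)) ∧
      (φ x (2 ^ j) * volume (B i k) < 1 →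
        essSup (fun y => φ y (β / 2 * 2 ^ j)) (volume.restrict (B i k)) ≤
          max 1 (φ x (2 ^ j)))}, hA0.and hall, ?_⟩
  rintro x ⟨hx0, hx⟩ y ⟨hy0, hy⟩ t hxy
  rcases eq_or_ne t 0 with rfl | ht
  · simp [hφ.map_zero]
  rcases eq_or_ne x y with rfl | hne
  · exact (hφ.monotone x (mul_le_of_le_one_left' hκ1)).trans (le_max_right _ _)
  have hd : 0 < nndist x y := by
    rw [← NNReal.coe_pos, coe_nndist]; exact dist_pos.2 hne
  obtain ⟨k, hk1, hk2⟩ := exists_mem_Ioc_zpow hd (one_lt_two : (1 : ℝ≥0) < 2)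
  -- the ball of radius `2 ^ (k + 2)` contains both points and has radius at most `4 |x - y|`
  obtain ⟨i, hi⟩ := (TopologicalSpace.denseRange_denseSeq (EuclideanSpace ℝ (Fin n))).exists_dist_lt
    x (show (0 : ℝ) < ((2 : ℝ≥0) ^ (k + 1) : ℝ≥0) by exact_mod_cast zpow_pos h2 _)
  have hrr : (2 : ℝ≥0) ^ (k + 2) = 2 ^ (k + 1) + 2 ^ (k + 1) := by
    rw [show k + 2 = (k + 1) + 1 by ring, zpow_add₀ (a := (2 : ℝ≥0)) two_ne_zero (k + 1) 1,
      zpow_one, mul_two]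
  have hxB : x ∈ B i (k + 2) := by
    simp only [B, Metric.mem_ball, hrr, NNReal.coe_add]
    have : (0 : ℝ) < ((2 : ℝ≥0) ^ (k + 1) : ℝ≥0) := by exact_mod_cast zpow_pos h2 _
    linarith
  have hyB : y ∈ B i (k + 2) := by
    simp only [B, Metric.mem_ball, hrr, NNReal.coe_add]
    have h3 : dist x y ≤ ((2 : ℝ≥0) ^ (k + 1) : ℝ≥0) := by
      rw [← coe_nndist]; exact_mod_cast hk2
    have := dist_triangle_left y (TopologicalSpace.denseSeq _ i) x
    linarith
  have hvol : volume (B i (k + 2)) ≤ ((4 ^ n * unitVol n) * nndist x y ^ n : ℝ≥0) := by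
    rw [hBvol]
    have h4 : (2 : ℝ≥0) ^ (k + 2) ≤ 4 * nndist x y := by
      rw [zpow_add₀ (a := (2 : ℝ≥0)) two_ne_zero k 2, mul_comm]
      gcongr
      norm_num
    have : ((2 : ℝ≥0) ^ (k + 2)) ^ n * unitVol n ≤ (4 * nndist x y) ^ n * unitVol n := by gcongr
    refine ENNReal.coe_le_coe.2 (this.trans_eq ?_)
    rw [mul_pow]; ring
  have hsmall : ∀ s ≤ t, φ x s * volume (B i (k + 2)) < 1 := by
    intro s hs
    calc φ x s * volume (B i (k + 2))
        ≤ φ x t * ((4 ^ n * unitVol n) * nndist x y ^ n : ℝ≥0) := by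
          gcongr; exact hφ.monotone x hs
      _ = φ x t * (nndist x y ^ n : ℝ≥0) * (4 ^ n * unitVol n : ℝ≥0) := by
          rw [mul_comm _ (nndist x y ^ n), ENNReal.coe_mul, mul_assoc]
      _ ≤ κ * (4 ^ n * unitVol n : ℝ≥0) := by gcongr
      _ < 1 := by exact_mod_cast hκω
  rcases le_or_gt (volume (B i (k + 2))) 1 with hB1 | hB1
  · obtain ⟨j, hj1, hj2⟩ := exists_mem_Ico_zpow (pos_iff_ne_zero.2 ht) (one_lt_two : (1 : ℝ≥0) < 2)
    have hκt : κ * t ≤ β / 2 * 2 ^ j := by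
      calc κ * t ≤ β / 4 * 2 ^ (j + 1) := by gcongr
        _ = β / 2 * 2 ^ j := by
          rw [zpow_add₀ (a := (2 : ℝ≥0)) two_ne_zero j 1, zpow_one]
          rw [show (4 : ℝ≥0) = 2 * 2 by norm_num]
          field_simp
    calc φ y (κ * t) ≤ φ y (β / 2 * 2 ^ j) := hφ.monotone y hκt
      _ ≤ _ := (hy i (k + 2) hB1 j hyB).1
      _ ≤ max 1 (φ x (2 ^ j)) := (hx i (k + 2) hB1 j hxB).2 (hsmall _ hj1)
      _ ≤ max 1 (φ x t) := max_le_max_left _ (hφ.monotone x hj1)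
  · -- on large balls the values are below `1`, and (A0) suffices
    have hx1 : φ x t < 1 := by
      by_contra hge
      have := hsmall t le_rfl
      exact absurd this (not_lt.2 ((mul_le_mul' (not_lt.1 hge) hB1.le).trans' (by simp)))
    have ht' : t ≤ 1 / β₀ := by
      have := (le_genInv (hφ.monotone x) hx1).trans hx0.2
      rw [← ENNReal.coe_one, ← ENNReal.coe_div hβ₀.ne'] at this
      exact_mod_cast this
    refine le_max_of_le_left (le_of_lt (lt_of_lt_genInv (lt_of_lt_of_le ?_ hy0.1)))
    have : κ * t < β₀ := by
      calc κ * t ≤ β₀ * β₀ / 2 * (1 / β₀) := by gcongr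
        _ = β₀ / 2 := by field_simp
        _ < β₀ := half_lt_self hβ₀
    exact_mod_cast this

end distance

/-! ### Replacing small values by the limit function -/

section glue

variable {n : ℕ} {φ : EuclideanSpace ℝ (Fin n) → ℝ≥0 → ℝ≥0∞} {g : ℝ≥0 → ℝ≥0∞} {t₀ D : ℝ≥0}

/-- The function that equals `g` on `[0, t₀]` and `φ(x, D t)` for `t > t₀`. At the exceptional
points `x` where `φ(x, D t₀) < 1` it equals `g` throughout, so that it is monotone at every
point. -/
def glue (φ : EuclideanSpace ℝ (Fin n) → ℝ≥0 → ℝ≥0∞) (g : ℝ≥0 → ℝ≥0∞) (t₀ D : ℝ≥0)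
    (x : EuclideanSpace ℝ (Fin n)) (t : ℝ≥0) : ℝ≥0∞ :=
  open Classical in if t₀ < t ∧ 1 ≤ φ x (D * t₀) then φ x (D * t) else g t

theorem glue_of_le {t : ℝ≥0} (h : t ≤ t₀) (x : EuclideanSpace ℝ (Fin n)) :
    glue φ g t₀ D x t = g t := by
  simp [glue, not_lt.2 h]

theorem glue_of_lt {x : EuclideanSpace ℝ (Fin n)} (hx : 1 ≤ φ x (D * t₀)) {t : ℝ≥0}
    (h : t₀ < t) : glue φ g t₀ D x t = φ x (D * t) := by
  simp [glue, h, hx]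

theorem glue_of_not_le {x : EuclideanSpace ℝ (Fin n)} (hx : ¬ 1 ≤ φ x (D * t₀)) (t : ℝ≥0) :
    glue φ g t₀ D x t = g t := by
  simp [glue, hx]

/-- An almost increasing quotient is inherited from both pieces. At the junction, the value of `g`
is at most `1` and that of `φ` is at least `1`. -/
theorem PowInc.glue {p : ℝ} {a : ℝ≥0} (ha : 1 ≤ a) (ht₀ : 0 < t₀) (hg1 : g t₀ ≤ 1)
    {x : EuclideanSpace ℝ (Fin n)} (hx : 1 ≤ φ x (D * t₀)) (hφ : PowInc p a (φ x))
    (hg : ∀ c t : ℝ≥0, c ≤ 1 → t ≤ t₀ → g (c * t) ≤ (a * c ^ p : ℝ≥0) * g t) :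
    PowInc p (a * a) (glue φ g t₀ D x) := by
  intro c t hc
  have haa : a ≤ a * a := le_mul_of_one_le_left zero_le ha
  rcases le_or_gt t t₀ with ht | ht
  · rw [glue_of_le ht, glue_of_le ((mul_le_of_le_one_left' hc).trans ht)]
    refine (hg c t hc ht).trans ?_
    gcongr
  rcases le_or_gt (c * t) t₀ with hct | hct
  · rw [glue_of_le hct, glue_of_lt hx ht]
    have ht0 : 0 < t := ht₀.trans ht
    have h1 := hg (c * t / t₀) t₀ (div_le_one_of_le₀ hct zero_le) le_rfl
    rw [div_mul_cancel₀ _ ht₀.ne'] at h1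
    have h2 := hφ (t₀ / t) (D * t) (div_le_one_of_le₀ ht.le zero_le)
    rw [show t₀ / t * (D * t) = D * t₀ by field_simp] at h2
    calc g (c * t) ≤ (a * (c * t / t₀) ^ p : ℝ≥0) * g t₀ := h1
      _ ≤ (a * (c * t / t₀) ^ p : ℝ≥0) * ((a * (t₀ / t) ^ p : ℝ≥0) * φ x (D * t)) := by
          gcongr; exact hg1.trans (hx.trans h2)
      _ = (a * a * c ^ p : ℝ≥0) * φ x (D * t) := by
          rw [← mul_assoc, ← ENNReal.coe_mul]
          congr 2
          rw [mul_mul_mul_comm, ← NNReal.mul_rpow]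
          congr 2
          field_simp
  · rw [glue_of_lt hx hct, glue_of_lt hx ht, mul_left_comm]
    refine (hφ c (D * t) hc).trans ?_
    gcongr

variable (hφ : IsWeakPhi φ) (hg : IsWeakPhi (fun _ : EuclideanSpace ℝ (Fin n) => g))
  (ht₀ : 0 < t₀) (hD : 0 < D) (hg1 : g t₀ < 1) (hgood : ∀ᵐ x, 1 ≤ φ x (D * t₀))

theorem glue_mono (hφ : IsWeakPhi φ) (hg : IsWeakPhi (fun _ : EuclideanSpace ℝ (Fin n) => g))
    (hg1 : g t₀ < 1) (x : EuclideanSpace ℝ (Fin n)) : Monotone (glue φ g t₀ D x) := by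
  intro s t hst
  by_cases hx : 1 ≤ φ x (D * t₀)
  · rcases le_or_gt t t₀ with ht | ht
    · rw [glue_of_le ht, glue_of_le (hst.trans ht)]
      exact hg.monotone x hst
    rcases le_or_gt s t₀ with hs | hs
    · rw [glue_of_le hs, glue_of_lt hx ht]
      calc g s ≤ g t₀ := hg.monotone x hs
        _ ≤ 1 := hg1.le
        _ ≤ _ := hx
        _ ≤ _ := hφ.monotone x (by gcongr)
    · rw [glue_of_lt hx hs, glue_of_lt hx ht]
      exact hφ.monotone x (by gcongr)
  · rw [glue_of_not_le hx, glue_of_not_le hx]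
    exact hg.monotone x hst

include hφ hg ht₀ hD hg1 hgood in
theorem isWeakPhi_glue : IsWeakPhi (glue φ g t₀ D) where
  measurable_comp := by
    intro f hf
    have hS : NullMeasurableSet {x | t₀ < f x} volume :=
      nullMeasurableSet_lt aemeasurable_const hf
    have h1 : AEMeasurable ({x | t₀ < f x}.indicator fun x => φ x (D * f x)) volume :=
      (hφ.measurable_comp _ (hf.const_mul D)).indicator₀ hS
    have h2 : AEMeasurable ({x | t₀ < f x}ᶜ.indicator fun x => g (f x)) volume :=
      (hg.measurable_comp f hf).indicator₀ hS.compl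
    refine (h1.add h2).congr ?_
    filter_upwards [hgood] with x hx
    rcases le_or_gt (f x) t₀ with h | h
    · have hxS : x ∉ {x | t₀ < f x} := not_lt.2 h
      rw [glue_of_le h, Pi.add_apply, Set.indicator_of_notMem hxS,
        Set.indicator_of_mem (Set.mem_compl hxS), zero_add]
    · have hxS : x ∈ {x | t₀ < f x} := h
      rw [glue_of_lt hx h, Pi.add_apply, Set.indicator_of_mem hxS,
        Set.indicator_of_notMem (Set.notMem_compl_iff.2 hxS), add_zero]
  monotone := glue_mono hφ hg hg1
  map_zero := fun x => by rw [glue_of_le zero_le]; exact hg.map_zero x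
  tendsto_zero := fun x => by
    refine (hg.tendsto_zero x).congr' ?_
    filter_upwards [nhdsWithin_le_nhds (Iic_mem_nhds ht₀)] with t ht
    exact (glue_of_le ht x).symm
  tendsto_top := fun x => by
    by_cases hx : 1 ≤ φ x (D * t₀)
    · refine ((hφ.tendsto_top x).comp (tendsto_id.const_mul_atTop hD)).congr' ?_
      filter_upwards [eventually_gt_atTop t₀] with t ht
      exact (glue_of_lt hx ht).symm
    · exact (hg.tendsto_top x).congr fun t => (glue_of_not_le hx t).symm
  almost_increasing := by
    obtain ⟨L₁, hL₁, h1⟩ := hφ.exists_powInc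
    obtain ⟨L₂, hL₂, h2⟩ := hg.exists_powInc
    have hL : 1 ≤ max L₁ L₂ := hL₁.trans (le_max_left _ _)
    refine ⟨max L₁ L₂ * max L₁ L₂, one_le_mul hL hL, fun x => ?_⟩
    have key : PowInc 1 (max L₁ L₂ * max L₁ L₂) (glue φ g t₀ D x) := by
      by_cases hx : 1 ≤ φ x (D * t₀)
      · refine PowInc.glue hL ht₀ hg1.le hx (fun c t hc => (h1 x c t hc).trans ?_)
          (fun c t hc _ => (h2 x c t hc).trans ?_)
        · gcongr; exact le_max_left _ _
        · gcongr; exact le_max_right _ _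
      · intro c t hc
        rw [glue_of_not_le hx, glue_of_not_le hx]
        refine (h2 x c t hc).trans ?_
        gcongr
        exact (le_max_right L₁ L₂).trans (le_mul_of_one_le_left zero_le hL)
    have h0 : glue φ g t₀ D x 0 = 0 := key.map_zero one_pos
    simpa using (powInc_iff one_pos (one_le_mul hL hL) h0).1 key

include ht₀ hg1 hgood hg hφ in
theorem a0_glue : A0 (glue φ g t₀ D) := by
  refine ⟨min 1 (min t₀ (1 / (2 * t₀))), by positivity, min_le_left _ _, ?_⟩
  filter_upwards [hgood] with x hx
  constructor
  · refine le_trans ?_ (le_genInv (glue_mono hφ hg hg1 x) (τ := t₀)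
      (by rw [glue_of_le le_rfl]; exact hg1))
    exact_mod_cast (min_le_right _ _).trans (min_le_left _ _)
  · refine (genInv_le (τ := 2 * t₀) ?_).trans ?_
    · have : t₀ < 2 * t₀ := lt_mul_of_one_lt_left ht₀ one_lt_two
      rw [glue_of_lt hx this]
      exact hx.trans (hφ.monotone x (by gcongr))
    · rw [one_div, ← ENNReal.coe_inv (by positivity)]
      refine ENNReal.coe_le_coe.2 ?_
      rw [le_inv_comm₀ (by positivity) (by positivity), ← one_div]
      exact (min_le_right _ _).trans (min_le_right _ _)

include hD hg1 hgood hg hφ in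
theorem a1_glue (h1 : A1 φ) : A1 (glue φ g t₀ D) := by
  obtain ⟨β, hβ, hβ1, h⟩ := h1
  refine ⟨β, hβ, hβ1, fun c r hr hv => ?_⟩
  filter_upwards [h c r hr hv, ae_restrict_of_ae hgood] with x hx hxg
  filter_upwards [hx, ae_restrict_of_ae hgood] with y hy hyg
  intro τ hτ1 hτ2
  refine le_iInf₂ fun σ hσ => ?_
  have hσt : t₀ < σ := by
    by_contra hle
    rw [not_lt] at hle
    rw [glue_of_le hle] at hσ
    exact absurd (hτ1.trans (hσ.trans (hg.monotone x hle))) (not_le.2 hg1)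
  rw [glue_of_lt hyg hσt] at hσ
  have hinv : β * genInv φ x τ ≤ (D * σ : ℝ≥0) := (hy τ hτ1 hτ2).trans (genInv_le hσ)
  have hβ0 : (β : ℝ≥0∞) ≠ 0 := by simpa using hβ.ne'
  rw [mul_comm, ← ENNReal.le_div_iff_mul_le (Or.inl hβ0) (Or.inl ENNReal.coe_ne_top),
    ← ENNReal.coe_div hβ.ne'] at hinv
  rw [mul_comm, ← ENNReal.le_div_iff_mul_le (Or.inl hβ0) (Or.inl ENNReal.coe_ne_top),
    ← ENNReal.coe_div hβ.ne']
  refine ENNReal.le_of_forall_pos_le_add fun ε hε _ => ?_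
  rw [← ENNReal.coe_add]
  have hσε : σ / β < σ / β + ε := lt_add_of_pos_right _ hε
  have hlt : t₀ < σ / β + ε := by
    refine (hσt.trans_le ?_).trans hσε
    rw [le_div_iff₀ hβ]
    exact mul_le_of_le_one_right' hβ1.le
  refine genInv_le ?_
  rw [glue_of_lt hxg hlt]
  obtain ⟨ρ, hρ, hρτ⟩ := exists_lt_of_genInv_lt (s := ((D * (σ / β + ε) : ℝ≥0) : ℝ≥0∞))
    (hinv.trans_lt (by
      refine ENNReal.coe_lt_coe.2 ?_
      rw [mul_div_assoc]
      gcongr))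
  exact hρτ.trans (hφ.monotone x (by exact_mod_cast hρ.le))

include ht₀ hgood hg hφ in
theorem a2_glue : A2 (glue φ g t₀ D) := by
  obtain ⟨T, hT⟩ := ((hg.tendsto_top 0).eventually (lt_mem_nhds ENNReal.one_lt_top)).exists
  have hT0 : 0 < T := by
    rw [pos_iff_ne_zero]; rintro rfl
    simp [hg.map_zero 0] at hT
  refine ⟨g, fun _ => 0, min 1 (t₀ / T), 1 / 2, hg, by simp, by simp, by positivity,
    min_le_left _ _, by positivity, ?_⟩
  have half : ((1 / 2 : ℝ≥0) : ℝ≥0∞) < 1 := by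
    have : (1 / 2 : ℝ≥0) < 1 := NNReal.half_lt_self one_ne_zero
    exact_mod_cast this
  filter_upwards [hgood] with x hx t
  have hβt : min 1 (t₀ / T) * t ≤ t := mul_le_of_le_one_left' (min_le_left _ _)
  constructor
  · intro hgt
    have htT : t ≤ T := by
      by_contra hlt
      exact absurd (hT.le.trans (hg.monotone x (not_le.1 hlt).le))
        (not_le.2 (hgt.trans_lt half))
    have : min 1 (t₀ / T) * t ≤ t₀ := by
      calc _ ≤ t₀ / T * T := by gcongr; exact min_le_right _ _
        _ = t₀ := div_mul_cancel₀ _ hT0.ne'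
    rw [glue_of_le this]
    exact (hg.monotone x hβt).trans le_self_add
  · intro hgt
    have : t ≤ t₀ := by
      by_contra hlt
      rw [not_le] at hlt
      rw [glue_of_lt hx hlt] at hgt
      exact absurd (hx.trans (hφ.monotone x (by gcongr))) (not_le.2 (hgt.trans_lt half))
    rw [glue_of_le this]
    exact (hg.monotone x hβt).trans le_self_add

include hφ hg hgood in
/-- By (A2), the replacement of small values changes `φ` only up to weak equivalence. -/
theorem weaklyEquivalent_glue (hD1 : 1 ≤ D) {h : EuclideanSpace ℝ (Fin n) → ℝ≥0} {β s : ℝ≥0}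
    (hh : MemLp (fun x => (h x : ℝ)) 1 volume) (hβ : 0 < β) (hgs : g t₀ ≤ s)
    (h2 : ∀ᵐ x, ∀ t : ℝ≥0, (g t ≤ s → φ x (β * t) ≤ g t + h x) ∧
      (φ x t ≤ s → g (β * t) ≤ φ x t + h x)) : WeaklyEquivalent φ (glue φ g t₀ D) := by
  have hLβ : 1 / β ≤ max D (1 / β) := le_max_right _ _
  have hL1 : 1 ≤ max D (1 / β) := hD1.trans (le_max_left _ _)
  refine ⟨max D (1 / β), h, hL1, hh, ?_⟩
  filter_upwards [hgood, h2] with x hx h2x t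
  have hβt : β * (1 / β * t) = t := by field_simp
  constructor
  · rcases le_or_gt t t₀ with ht | ht
    · rw [glue_of_le ht]
      have hmono : φ x (1 / β * t) ≤ φ x (max D (1 / β) * t) := hφ.monotone x (by gcongr)
      rcases le_or_gt (φ x (1 / β * t)) s with hs | hs
      · have := (h2x (1 / β * t)).2 hs
        rw [hβt] at this
        exact this.trans (by gcongr)
      · exact ((hg.monotone x ht).trans (hgs.trans (hs.le.trans hmono))).trans le_self_add
    · rw [glue_of_lt hx ht]
      exact (hφ.monotone x (by gcongr; exact le_max_left _ _)).trans le_self_add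
  · rcases le_or_gt (max D (1 / β) * t) t₀ with ht | ht
    · rw [glue_of_le ht]
      have hmono : g (1 / β * t) ≤ g (max D (1 / β) * t) := hg.monotone x (by gcongr)
      have := (h2x (1 / β * t)).1 (hmono.trans ((hg.monotone x ht).trans hgs))
      rw [hβt] at this
      exact this.trans (by gcongr)
    · rw [glue_of_lt hx ht]
      refine (hφ.monotone x ?_).trans le_self_add
      calc t = 1 * (1 * t) := by simp
        _ ≤ D * (max D (1 / β) * t) := by gcongr

/-- `ψ(x, t)` and `ψ(y, κ t)` are comparable as long as `ψ(x, t)` does not exceed `κ / |x - y|ⁿ`,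
for all points outside a null set. There is neither a lower bound on the values nor an error
term. -/
def DistControl (ψ : EuclideanSpace ℝ (Fin n) → ℝ≥0 → ℝ≥0∞) : Prop :=
  ∃ κ : ℝ≥0, 0 < κ ∧ κ ≤ 1 ∧ ∃ G : Set (EuclideanSpace ℝ (Fin n)), (∀ᵐ x, x ∈ G) ∧
    ∀ x ∈ G, ∀ y ∈ G, ∀ t : ℝ≥0, ψ x t * (nndist x y ^ n : ℝ≥0) ≤ κ → ψ y (κ * t) ≤ ψ x t

include hφ hg hg1 hgood in
theorem distControl_glue (h0 : A0 φ) (h1 : A1 φ) : DistControl (glue φ g t₀ D) := by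
  obtain ⟨κ, hκ, hκ1, G, hG, h⟩ := exists_dist_control hφ h0 h1
  refine ⟨κ, hκ, hκ1, {x | x ∈ G ∧ 1 ≤ φ x (D * t₀)}, hG.and hgood, ?_⟩
  rintro x ⟨hxG, hx⟩ y ⟨hyG, hy⟩ t hle
  have hκt : κ * t ≤ t := mul_le_of_le_one_left' hκ1
  rcases le_or_gt t t₀ with ht | ht
  · rw [glue_of_le ht, glue_of_le (hκt.trans ht)]
    exact hg.monotone x hκt
  rw [glue_of_lt hx ht] at hle ⊢
  have hx1 : 1 ≤ φ x (D * t) := hx.trans (hφ.monotone x (by gcongr))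
  rcases le_or_gt (κ * t) t₀ with hκt₀ | hκt₀
  · rw [glue_of_le hκt₀]
    exact (hg.monotone x hκt₀).trans (hg1.le.trans hx1)
  · rw [glue_of_lt hy hκt₀, mul_left_comm]
    have := h x hxG y hyG (D * t) hle
    rwa [max_eq_right hx1] at this

end glue

/-- The parameters of the replacement can be chosen for the data of (A0) and (A2). The point `t₀`
may be taken as small as desired. -/
theorem exists_glue_parameters {n : ℕ} {φ : EuclideanSpace ℝ (Fin n) → ℝ≥0 → ℝ≥0∞} (h0 : A0 φ)
    (hφ : IsWeakPhi φ) {g : ℝ≥0 → ℝ≥0∞} (hg : IsWeakPhi (fun _ : EuclideanSpace ℝ (Fin n) => g))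
    {s T : ℝ≥0} (hs : 0 < s) (hT : 0 < T) :
    ∃ t₀ D : ℝ≥0, 0 < t₀ ∧ t₀ ≤ T ∧ 1 ≤ D ∧ g t₀ < 1 ∧ g t₀ ≤ s ∧
      ∀ᵐ x, 1 ≤ φ x (D * t₀) := by
  have h1 : ∀ᶠ t in 𝓝[>] (0 : ℝ≥0), g t < min 1 (s : ℝ≥0∞) :=
    (hg.tendsto_zero 0).eventually (gt_mem_nhds (by simpa using hs))
  have h2 : ∀ᶠ t in 𝓝[>] (0 : ℝ≥0), t ≤ T := nhdsWithin_le_nhds (Iic_mem_nhds hT)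
  obtain ⟨t₀, ⟨hgt, htT⟩, ht₀⟩ := ((h1.and h2).and self_mem_nhdsWithin).exists
  have ht₀ : 0 < t₀ := ht₀
  obtain ⟨β, hβ, -, hA⟩ := h0
  refine ⟨t₀, max 1 (2 / (β * t₀)), ht₀, htT, le_max_left _ _, (lt_min_iff.1 hgt).1,
    (lt_min_iff.1 hgt).2.le, ?_⟩
  filter_upwards [hA] with x hx
  obtain ⟨τ, hτ, hτ1⟩ := exists_lt_of_genInv_lt (s := ((max 1 (2 / (β * t₀)) * t₀ : ℝ≥0) : ℝ≥0∞))
    (hx.2.trans_lt (by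
      rw [← ENNReal.coe_one, ← ENNReal.coe_div hβ.ne']
      refine ENNReal.coe_lt_coe.2 ?_
      calc 1 / β < 2 / β := by gcongr; exact one_lt_two
        _ = 2 / (β * t₀) * t₀ := by field_simp
        _ ≤ _ := by gcongr; exact le_max_right _ _))
  exact hτ1.trans (hφ.monotone x (by exact_mod_cast hτ.le))

/-! ### Necessity: boundedness of the maximal operator yields (aInc) -/

section necessity

variable {n : ℕ} {ψ : EuclideanSpace ℝ (Fin n) → ℝ≥0 → ℝ≥0∞}

/-- If a function is at least `b 2 ^ (n k)` on the `k`-th dyadic annulus, counted inwards from the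
outermost one, then each annulus contributes the same amount to the integral. -/
theorem mul_le_lintegral_of_annuli (hn : 1 ≤ n) (Ψ : EuclideanSpace ℝ (Fin n) → ℝ≥0∞)
    (x : EuclideanSpace ℝ (Fin n)) {ρ : ℝ≥0} (hρ : 0 < ρ) (b : ℝ≥0) (N : ℕ)
    (h : ∀ m k : ℕ, m + 1 + k = N → ∀ᵐ y, y ∈ Metric.ball x ((2 ^ (m + 1) * ρ : ℝ≥0) : ℝ) →
      (((2 : ℝ≥0) ^ n) ^ k * b : ℝ≥0) ≤ Ψ y) :
    ((N * ((2 : ℝ≥0) ^ n) ^ N * (ρ ^ n * unitVol n) * b : ℝ≥0) : ℝ≥0∞) ≤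
      ((2 : ℝ≥0) ^ n : ℝ≥0) * ∫⁻ y, Ψ y := by
  set q : ℝ≥0 := (2 : ℝ≥0) ^ n with hq
  have hq2 : 2 ≤ q := by
    calc (2 : ℝ≥0) = 2 ^ 1 := (pow_one _).symm
      _ ≤ 2 ^ n := pow_le_pow_right₀ one_le_two hn
  have hvol : ∀ m : ℕ, volume (Metric.ball x ((2 ^ m * ρ : ℝ≥0) : ℝ)) =
      (q ^ m * (ρ ^ n * unitVol n) : ℝ≥0) := by
    intro m
    rw [volume_ball_eq x (by positivity)]
    congr 1
    rw [mul_pow, ← pow_mul, mul_comm m n, pow_mul, ← hq, mul_assoc]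
  have key : ∀ m : ℕ, m ≤ N → ((m * q ^ N * (ρ ^ n * unitVol n) * b : ℝ≥0) : ℝ≥0∞) ≤
      q * ∫⁻ y in Metric.ball x ((2 ^ m * ρ : ℝ≥0) : ℝ), Ψ y := by
    intro m
    induction m with
    | zero => intro _; simp
    | succ m ih =>
      intro hm
      obtain ⟨k, hk⟩ := Nat.exists_eq_add_of_le hm
      set B₀ := Metric.ball x ((2 ^ m * ρ : ℝ≥0) : ℝ) with hB₀
      set B₁ := Metric.ball x ((2 ^ (m + 1) * ρ : ℝ≥0) : ℝ) with hB₁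
      have hsub : B₀ ⊆ B₁ := by
        refine Metric.ball_subset_ball ?_
        have : 2 ^ m * ρ ≤ 2 ^ (m + 1) * ρ := by
          gcongr
          · exact one_le_two
          · omega
        exact_mod_cast this
      have hA : ((q ^ m * (ρ ^ n * unitVol n) : ℝ≥0) : ℝ≥0∞) ≤ volume (B₁ \ B₀) := by
        have h1 : volume B₁ ≤ volume (B₁ \ B₀) + volume B₀ := by
          refine (measure_mono ?_).trans (measure_union_le _ _)
          intro y hy
          by_cases hy0 : y ∈ B₀
          · exact Or.inr hy0
          · exact Or.inl ⟨hy, hy0⟩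
        rw [hB₀, hB₁, hvol, hvol] at h1
        refine (ENNReal.add_le_add_iff_right (ENNReal.coe_ne_top
          (r := q ^ m * (ρ ^ n * unitVol n)))).1 (le_trans ?_ h1)
        rw [← ENNReal.coe_add, ENNReal.coe_le_coe, ← two_mul, pow_succ, mul_comm (q ^ m) q,
          mul_assoc]
        gcongr
      have hint : ((q ^ k * b : ℝ≥0) : ℝ≥0∞) * volume (B₁ \ B₀) ≤ ∫⁻ y in B₁ \ B₀, Ψ y := by
        rw [← setLIntegral_const]
        refine setLIntegral_mono_ae' (measurableSet_ball.diff measurableSet_ball) ?_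
        filter_upwards [h m k hk.symm] with y hy hyA
        exact hy hyA.1
      calc (((m + 1 : ℕ) * q ^ N * (ρ ^ n * unitVol n) * b : ℝ≥0) : ℝ≥0∞)
          = (m * q ^ N * (ρ ^ n * unitVol n) * b : ℝ≥0) +
            q * (((q ^ k * b : ℝ≥0) : ℝ≥0∞) * (q ^ m * (ρ ^ n * unitVol n) : ℝ≥0)) := by
            rw [← ENNReal.coe_mul, ← ENNReal.coe_mul, ← ENNReal.coe_add, hk]
            congr 1
            push_cast
            ring
        _ ≤ q * (∫⁻ y in B₀, Ψ y) + q * ∫⁻ y in B₁ \ B₀, Ψ y := by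
            refine add_le_add (ih (by omega)) (mul_le_mul_right (le_trans ?_ hint) _)
            gcongr
        _ = q * ∫⁻ y in B₁, Ψ y := by
            rw [← mul_add]
            congr 1
            have := lintegral_inter_add_sdiff (μ := volume) Ψ B₁ (measurableSet_ball (x := x)
              (ε := ((2 ^ m * ρ : ℝ≥0) : ℝ)))
            rwa [← hB₀, Set.inter_eq_self_of_subset_right hsub] at this
  exact (key N le_rfl).trans (mul_le_mul_right (setLIntegral_le_lintegral _ _) _)

theorem le_maximalFn_indicator (x : EuclideanSpace ℝ (Fin n)) {ρ a Q : ℝ≥0} (hρ : 0 < ρ)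
    (hQ : 1 ≤ Q) {y : EuclideanSpace ℝ (Fin n)} (hy : y ∈ Metric.ball x ((Q * ρ : ℝ≥0) : ℝ)) :
    ((a / Q ^ n : ℝ≥0) : ℝ≥0∞) ≤
      maximalFn ((Metric.ball x (ρ : ℝ)).indicator fun _ => (a : ℝ)) y := by
  have hQ0 : 0 < Q := zero_lt_one.trans_le hQ
  have hω := unitVol_pos n
  refine le_trans (le_of_eq ?_) (le_ballMax _ hy)
  have hsub : Metric.ball x (ρ : ℝ) ⊆ Metric.ball x ((Q * ρ : ℝ≥0) : ℝ) :=
    Metric.ball_subset_ball (by exact_mod_cast le_mul_of_one_le_left zero_le hQ)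
  have hint : ∫⁻ y in Metric.ball x ((Q * ρ : ℝ≥0) : ℝ),
      ‖(Metric.ball x (ρ : ℝ)).indicator (fun _ => (a : ℝ)) y‖ₑ =
      a * (ρ ^ n * unitVol n : ℝ≥0) := by
    simp only [enorm_indicator_eq_indicator_enorm]
    rw [lintegral_indicator measurableSet_ball, Measure.restrict_restrict measurableSet_ball,
      Set.inter_eq_self_of_subset_left hsub, setLIntegral_const, volume_ball_eq x hρ]
    simp [enorm_eq_nnnorm]
  rw [hint, volume_ball_eq x (by positivity), one_div, ← ENNReal.coe_inv (by positivity),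
    ← ENNReal.coe_mul, ← ENNReal.coe_mul, mul_pow]
  congr 1
  field_simp

/-- If the maximal operator is bounded, then `ψ(x, ·)` gains a factor `1 / 2` over linear growth
when the argument is multiplied by a fixed small number `θ`. The test function is a multiple of the
indicator of a ball centred at `x`; each of `N` dyadic annuli around this ball contributes equally
to the modular of its maximal function, and `N` is chosen large. -/
theorem exists_le_half_of_modularBounded (hn : 1 ≤ n) (hψ : IsWeakPhi ψ) (hd : DistControl ψ)
    (hb : ModularBounded ψ) :
    ∃ θ : ℝ≥0, 0 < θ ∧ θ < 1 ∧ ∀ᵐ x, ∀ t, ψ x (θ * t) ≤ (θ / 2 : ℝ≥0) * ψ x t := by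
  obtain ⟨L, hL, hLψ⟩ := hψ.exists_powInc
  obtain ⟨κ, hκ, hκ1, G, hG, hGψ⟩ := hd
  obtain ⟨K, hK, hb⟩ := hb
  have hω := unitVol_pos n
  set q : ℝ≥0 := (2 : ℝ≥0) ^ n with hq
  have hq2 : 2 ≤ q := by
    calc (2 : ℝ≥0) = 2 ^ 1 := (pow_one _).symm
      _ ≤ 2 ^ n := pow_le_pow_right₀ one_le_two hn
  have hq0 : 0 < q := two_pos.trans_le hq2
  have hq1 : 1 ≤ q := one_le_two.trans hq2
  set C : ℝ≥0 := max 1 (L * (κ * unitVol n)) with hC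
  have hC0 : 0 < C := by positivity
  set c : ℝ≥0 := min 1 (κ / C / K) with hc
  have hc0 : 0 < c := by positivity
  obtain ⟨N, hN⟩ := exists_nat_ge (2 * (L * L) * q / (κ * κ * unitVol n * c) + 1)
  have hN1 : 1 ≤ N := by
    have : (1 : ℝ≥0) ≤ N := le_add_self.trans hN
    exact_mod_cast this
  have hNL : L * L * q * 2 ≤ N * (κ * κ * unitVol n * c) := by
    rw [← div_le_iff₀ (by positivity)]
    refine le_trans (le_of_eq ?_) (le_self_add.trans hN)
    ring
  set θ : ℝ≥0 := κ * c / q ^ N with hθ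
  have hθ1 : θ < 1 := by
    rw [hθ, div_lt_one (by positivity)]
    calc κ * c ≤ 1 * 1 := by gcongr; exact min_le_left _ _
      _ < q ^ N := by rw [one_mul]; exact one_lt_pow₀ (one_lt_two.trans_le hq2) (by omega)
  refine ⟨θ, by positivity, hθ1, ?_⟩
  filter_upwards [hG] with x hx t
  have hθt : θ * t ≤ t := mul_le_of_le_one_left' hθ1.le
  by_cases htop : ψ x t = ⊤
  · have : ((θ / 2 : ℝ≥0) : ℝ≥0∞) ≠ 0 := ENNReal.coe_ne_zero.2 (by positivity)
    rw [htop, ENNReal.mul_top this]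
    exact le_top
  rcases eq_or_ne (ψ x t) 0 with h0 | h0
  · rw [h0, mul_zero, ← h0]
    exact hψ.monotone x hθt
  obtain ⟨τ, hτ⟩ : ∃ τ : ℝ≥0, (τ : ℝ≥0∞) = ψ x t := ⟨_, ENNReal.coe_toNNReal htop⟩
  obtain ⟨b, hbb⟩ : ∃ b : ℝ≥0, (b : ℝ≥0∞) = ψ x (θ * t) :=
    ⟨_, ENNReal.coe_toNNReal (ne_top_of_le_ne_top htop (hψ.monotone x hθt))⟩
  have hτ0 : 0 < τ := by
    rw [← hτ] at h0
    exact pos_iff_ne_zero.2 (by exact_mod_cast h0)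
  -- the radius for which the modular of `κ t 1_{B(x, ρ)}` is bounded by a constant
  set ρ : ℝ≥0 := (κ / τ) ^ ((n : ℝ)⁻¹) with hρ
  have hρ0 : 0 < ρ := NNReal.rpow_pos (by positivity)
  have hρn : ρ ^ n = κ / τ := NNReal.rpow_inv_natCast_pow _ (by omega)
  set f : EuclideanSpace ℝ (Fin n) → ℝ :=
    (Metric.ball x (ρ : ℝ)).indicator fun _ => ((κ * t : ℝ≥0) : ℝ) with hf
  have hfm : Measurable f := measurable_const.indicator measurableSet_ball
  have hmod : ∫⁻ y, extendTop ψ y ‖f y‖ₑ ≤ (κ * unitVol n : ℝ≥0) := by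
    calc ∫⁻ y, extendTop ψ y ‖f y‖ₑ
        ≤ ∫⁻ y, (Metric.ball x (ρ : ℝ)).indicator (fun _ => (τ : ℝ≥0∞)) y := by
          refine lintegral_mono_ae ?_
          filter_upwards [hG] with y hy
          by_cases hyB : y ∈ Metric.ball x (ρ : ℝ)
          · rw [hf, Set.indicator_of_mem hyB, Set.indicator_of_mem hyB, enorm_eq_nnnorm,
              NNReal.nnnorm_eq, extendTop_coe, hτ]
            refine hGψ x hx y hy t ?_
            have hd : nndist x y ≤ ρ := by
              have : dist x y ≤ ρ := (dist_comm x y).trans_le (le_of_lt hyB)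
              exact_mod_cast this
            rw [← hτ, ← ENNReal.coe_mul, ENNReal.coe_le_coe]
            calc τ * nndist x y ^ n ≤ τ * ρ ^ n := by gcongr
              _ = κ := by rw [hρn]; field_simp
          · rw [hf, Set.indicator_of_notMem hyB, Set.indicator_of_notMem hyB, enorm_zero,
              ← ENNReal.coe_zero, extendTop_coe, hψ.map_zero, ENNReal.coe_zero]
      _ = (κ * unitVol n : ℝ≥0) := by
          rw [lintegral_indicator_const measurableSet_ball, volume_ball_eq x hρ0, hρn,
            ← ENNReal.coe_mul]
          congr 1
          field_simp
  have hmax := hb (fun y => f y / C) (hfm.div_const _).aemeasurable (by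
    simpa only [enorm_div_coe _ hC0] using lintegral_extendTop_div_le_one hL hLψ hmod
      (le_max_left _ _) (le_max_right _ _))
  simp only [maximalFn_div _ hC0] at hmax
  have hann := mul_le_lintegral_of_annuli hn
    (fun y => (L * L : ℝ≥0) * extendTop ψ y (maximalFn f y / C / K)) x hρ0 b N (by
      intro m k hk
      filter_upwards [hG] with y hyG hy
      set σ : ℝ≥0 := c * t / q ^ (m + 1) with hσ
      have hpow : ((2 : ℝ≥0) ^ (m + 1)) ^ n = q ^ (m + 1) := by
        rw [hq, ← pow_mul, ← pow_mul, mul_comm]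
      have hM : ψ y σ ≤ extendTop ψ y (maximalFn f y / C / K) := by
        rw [← extendTop_coe (φ := ψ)]
        refine hψ.extendTop_mono y ?_
        have := le_maximalFn_indicator (a := κ * t) x hρ0 (one_le_pow₀ one_le_two) hy
        rw [hpow] at this
        refine le_trans ?_ (ENNReal.div_le_div_right (ENNReal.div_le_div_right this _) _)
        rw [← ENNReal.coe_div hC0.ne', ← ENNReal.coe_div hK.ne', ENNReal.coe_le_coe]
        calc c * t / q ^ (m + 1) ≤ κ / C / K * t / q ^ (m + 1) := by
              gcongr; exact min_le_right _ _
          _ = _ := by ring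
      have hκσ : κ * σ = κ * c / q ^ (m + 1) * t := by rw [hσ]; ring
      -- comparison of the values at `y` and at the centre `x`
      have hcmp : ψ x (κ * σ) ≤ L * ψ y σ := by
        rcases le_or_gt (ψ y σ * (nndist y x ^ n : ℝ≥0)) κ with hle | hlt
        · refine (hGψ y hyG x hx σ hle).trans (le_mul_of_one_le_left zero_le ?_)
          exact_mod_cast hL
        · have hd : nndist y x ≤ 2 ^ (m + 1) * ρ := by
            have : dist y x ≤ ((2 ^ (m + 1) * ρ : ℝ≥0) : ℝ) := le_of_lt hy
            exact_mod_cast this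
          have h1 : (κ : ℝ≥0∞) ≤ ψ y σ * (q ^ (m + 1) * (κ / τ) : ℝ≥0) := by
            refine hlt.le.trans ?_
            gcongr
            calc nndist y x ^ n ≤ (2 ^ (m + 1) * ρ) ^ n := by gcongr
              _ = _ := by rw [mul_pow, hpow, hρn]
          have h2 : (κ * c / q ^ (m + 1) : ℝ≥0) ≤ 1 := by
            rw [div_le_one (by positivity)]
            calc κ * c ≤ 1 * 1 := by gcongr; exact min_le_left _ _
              _ ≤ q ^ (m + 1) := by rw [one_mul]; exact one_le_pow₀ hq1
          calc ψ x (κ * σ) ≤ (L * (κ * c / q ^ (m + 1)) : ℝ≥0) * ψ x t := by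
                rw [hκσ]; exact (hLψ x).le_mul h2
            _ = (L * c * (τ / q ^ (m + 1)) : ℝ≥0) * κ := by
                rw [← hτ, ← ENNReal.coe_mul, ← ENNReal.coe_mul]; congr 1; ring
            _ ≤ (L * c * (τ / q ^ (m + 1)) : ℝ≥0) *
                (ψ y σ * (q ^ (m + 1) * (κ / τ) : ℝ≥0)) := by gcongr
            _ = (L * (c * κ) : ℝ≥0) * ψ y σ := by
                rw [mul_comm (ψ y σ), ← mul_assoc, ← ENNReal.coe_mul]
                congr 2
                field_simp
            _ ≤ L * ψ y σ := by
                gcongr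
                calc L * (c * κ) ≤ L * (1 * 1) := by gcongr; exact min_le_left _ _
                  _ = L := by simp
      have hgrow := (hLψ x).mul_le (c := q ^ k) (t := θ * t) (one_le_pow₀ hq1)
      have hθσ : q ^ k * (θ * t) = κ * σ := by
        rw [hκσ, hθ, ← hk, pow_add]
        field_simp
      rw [hθσ, ← hbb, ← ENNReal.coe_mul] at hgrow
      refine hgrow.trans ?_
      rw [ENNReal.coe_mul, mul_assoc]
      exact mul_le_mul_right (hcmp.trans (mul_le_mul_right hM _)) _)
  rw [lintegral_const_mul' _ _ ENNReal.coe_ne_top] at hann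
  have hfin : N * q ^ N * (κ / τ * unitVol n) * b ≤ q * (L * L) := by
    rw [← ENNReal.coe_le_coe, ← hρn]
    refine hann.trans ?_
    rw [ENNReal.coe_mul q]
    exact mul_le_mul_right (mul_le_of_le_one_right' hmax) _
  rw [← hbb, ← hτ, ← ENNReal.coe_mul, ENNReal.coe_le_coe]
  have hpos : 0 < N * q ^ N * (κ / τ * unitVol n) := by
    have : (0 : ℝ≥0) < N := by exact_mod_cast hN1
    positivity
  refine le_of_mul_le_mul_left (hfin.trans ?_) hpos
  calc q * (L * L) = L * L * q * 2 / 2 := by field_simp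
    _ ≤ N * (κ * κ * unitVol n * c) / 2 := by gcongr
    _ = N * q ^ N * (κ / τ * unitVol n) * (θ / 2 * τ) := by
      rw [hθ]
      field_simp

/-- Iteration of `F(θ t) ≤ (θ / 2) F(t)`. The exponent is determined by `θ ^ p = θ / 2`. -/
theorem exists_powInc_of_le_half {θ : ℝ≥0} (hθ : 0 < θ) (hθ1 : θ < 1) :
    ∃ p : ℝ, 1 < p ∧ ∃ a : ℝ≥0, 1 ≤ a ∧ ∀ F : ℝ≥0 → ℝ≥0∞, Monotone F → F 0 = 0 →
      (∀ t, F (θ * t) ≤ (θ / 2 : ℝ≥0) * F t) → PowInc p a F := by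
  have hθ' : (0 : ℝ) < θ := hθ
  have hθ1' : (θ : ℝ) < 1 := hθ1
  have hlog : Real.log θ < 0 := Real.log_neg hθ' hθ1'
  set p : ℝ := 1 + Real.log 2 / -Real.log θ with hp
  have hp1 : 1 < p := by
    have : 0 < Real.log 2 / -Real.log θ := div_pos (Real.log_pos one_lt_two) (by linarith)
    linarith
  have hθp : θ ^ p = θ / 2 := by
    rw [← NNReal.coe_inj, NNReal.coe_rpow, Real.rpow_def_of_pos hθ', NNReal.coe_div,
      show Real.log θ * p = Real.log θ - Real.log 2 by
        have := hlog.ne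
        rw [hp]; field_simp; ring, Real.exp_sub,
      Real.exp_log hθ', Real.exp_log two_pos]
    rfl
  have hθp0 : 0 < θ ^ p := NNReal.rpow_pos hθ
  refine ⟨p, hp1, (θ ^ p)⁻¹, ?_, fun F hF hF0 h => ?_⟩
  · rw [one_le_inv₀ hθp0]
    exact NNReal.rpow_le_one hθ1.le (by linarith)
  intro c t hc
  rcases eq_or_ne c 0 with rfl | hc0
  · simp [hF0]
  obtain ⟨k, hk1, hk2⟩ := exists_nat_pow_near_of_lt_one (pos_iff_ne_zero.2 hc0) hc hθ hθ1
  have hiter : ∀ k : ℕ, F (θ ^ k * t) ≤ ((θ ^ p) ^ k : ℝ≥0) * F t := by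
    intro k
    induction k with
    | zero => simp
    | succ k ih =>
      calc F (θ ^ (k + 1) * t) = F (θ * (θ ^ k * t)) := by congr 1; ring
        _ ≤ (θ ^ p : ℝ≥0) * F (θ ^ k * t) := by rw [hθp]; exact h _
        _ ≤ (θ ^ p : ℝ≥0) * (((θ ^ p) ^ k : ℝ≥0) * F t) := by gcongr
        _ = _ := by rw [← mul_assoc, ← ENNReal.coe_mul, ← pow_succ']
  calc F (c * t) ≤ F (θ ^ k * t) := hF (by gcongr)
    _ ≤ ((θ ^ p) ^ k : ℝ≥0) * F t := hiter k
    _ ≤ ((θ ^ p)⁻¹ * c ^ p : ℝ≥0) * F t := by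
      gcongr
      rw [le_inv_mul_iff₀ hθp0, ← pow_succ', ← NNReal.rpow_natCast, ← NNReal.rpow_mul,
        mul_comm, NNReal.rpow_mul, NNReal.rpow_natCast]
      gcongr

theorem aInc_of_modularBounded (hn : 1 ≤ n) (hψ : IsWeakPhi ψ) (hd : DistControl ψ)
    (hb : ModularBounded ψ) : AInc ψ := by
  obtain ⟨θ, hθ, hθ1, h⟩ := exists_le_half_of_modularBounded hn hψ hd hb
  obtain ⟨p, hp, a, ha, hF⟩ := exists_powInc_of_le_half hθ hθ1
  refine ⟨p, hp, (aIncExp_iff hψ (by linarith)).2 ⟨a, ha, ?_⟩⟩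
  filter_upwards [h] with x hx
  exact hF _ (hψ.monotone x) (hψ.map_zero x) hx

end necessity

/-! ### Sufficiency: (aInc) yields boundedness of the maximal operator -/

section sufficiency

variable {n : ℕ} {ψ : EuclideanSpace ℝ (Fin n) → ℝ≥0 → ℝ≥0∞}

/-- Jensen's inequality for the power `p` and the average over a set `B`. -/
theorem average_rpow_le {p : ℝ} (hp : 1 < p) {w : EuclideanSpace ℝ (Fin n) → ℝ≥0∞}
    (hw : AEMeasurable w volume) (hw1 : ∫⁻ y, w y ^ p ≤ 1) {B : Set (EuclideanSpace ℝ (Fin n))}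
    {V : ℝ≥0} (hV : 0 < V) (hB : volume B = V) :
    ((1 / (V : ℝ≥0∞)) * ∫⁻ y in B, w y) ^ p ≤ (V⁻¹ : ℝ≥0) := by
  have hp0 : 0 < p := by linarith
  have hpq := Real.HolderConjugate.conjExponent hp
  have h := ENNReal.lintegral_mul_le_Lp_mul_Lq (volume.restrict B) hpq hw.restrict
    (aemeasurable_const (b := (1 : ℝ≥0∞)))
  simp only [Pi.mul_apply, mul_one, ENNReal.one_rpow, lintegral_one, Measure.restrict_apply,
    MeasurableSet.univ, Set.univ_inter, hB] at h
  have h1 : (∫⁻ y in B, w y ^ p) ^ (1 / p) ≤ 1 :=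
    ENNReal.rpow_le_one ((setLIntegral_le_lintegral _ _).trans hw1) (by positivity)
  have h2 : ∫⁻ y in B, w y ≤ (V ^ (1 / p.conjExponent) : ℝ≥0) := by
    rw [ENNReal.coe_rpow_of_ne_zero hV.ne']
    exact h.trans (mul_le_of_le_one_left' h1)
  calc ((1 / (V : ℝ≥0∞)) * ∫⁻ y in B, w y) ^ p
      ≤ ((V⁻¹ : ℝ≥0) * (V ^ (1 / p.conjExponent) : ℝ≥0)) ^ p := by
        refine ENNReal.rpow_le_rpow ?_ hp0.le
        rw [one_div, ← ENNReal.coe_inv hV.ne']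
        gcongr
    _ = (V⁻¹ : ℝ≥0) := by
        rw [← ENNReal.coe_mul, ← ENNReal.coe_rpow_of_nonneg _ hp0.le]
        congr 1
        have hq : 1 / p.conjExponent = 1 - p⁻¹ := by
          rw [one_div, hpq.one_sub_inv]
        rw [← NNReal.rpow_neg_one, ← NNReal.rpow_add hV.ne', ← NNReal.rpow_mul, hq]
        congr 1
        field_simp
        ring

/-- The key estimate: an average of `|f|` over a ball around `x` is controlled by any `t` for which
`ψ(x, t)` exceeds the `p`-th power of the average of `ψ(·, |f|) ^ (1 / p)`. -/
theorem average_le_of_lt {p : ℝ} (hp : 1 < p) {a κ c₁ : ℝ≥0} (hκ : 0 < κ)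
    (hc₁ : 0 < c₁) (hc₁1 : c₁ ≤ 1) (hc₁κ : c₁ ≤ κ * unitVol n / 2 ^ n)
    {G : Set (EuclideanSpace ℝ (Fin n))} (hG : ∀ᵐ x, x ∈ G)
    (hGψ : ∀ x ∈ G, ∀ y ∈ G, ∀ t : ℝ≥0, ψ x t * (nndist x y ^ n : ℝ≥0) ≤ κ → ψ y (κ * t) ≤ ψ x t)
    (hinc : ∀ᵐ y, PowInc p a (ψ y)) {f : EuclideanSpace ℝ (Fin n) → ℝ}
    (hw : AEMeasurable (fun y => extendTop ψ y ‖f y‖ₑ ^ p⁻¹) volume)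
    (hf : ∫⁻ y, extendTop ψ y ‖f y‖ₑ ≤ 1) {x c : EuclideanSpace ℝ (Fin n)} (hx : x ∈ G)
    {r : ℝ} (hxc : x ∈ Metric.ball c r) {t : ℝ≥0}
    (ht : ((1 / volume (Metric.ball c r)) *
      ∫⁻ y in Metric.ball c r, extendTop ψ y ‖f y‖ₑ ^ p⁻¹) ^ p < ψ x t) :
    (1 / volume (Metric.ball c r)) * ∫⁻ y in Metric.ball c r, ‖f y‖ₑ ≤
      ((1 + (a / c₁) ^ p⁻¹) / κ * t : ℝ≥0) := by
  have hp0 : 0 < p := by linarith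
  have hω := unitVol_pos n
  have hr : 0 < r := Metric.pos_of_mem_ball hxc
  lift r to ℝ≥0 using hr.le
  have hr0 : 0 < r := hr
  set V : ℝ≥0 := r ^ n * unitVol n with hV
  have hV0 : 0 < V := by positivity
  have hB : volume (Metric.ball c (r : ℝ)) = V := volume_ball_eq c hr0
  set w : EuclideanSpace ℝ (Fin n) → ℝ≥0∞ := fun y => extendTop ψ y ‖f y‖ₑ ^ p⁻¹ with hwdef
  have hwp : ∫⁻ y, w y ^ p ≤ 1 := by
    simpa only [hwdef, ENNReal.rpow_inv_rpow hp0.ne'] using hf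
  have hJ := average_rpow_le hp hw hwp hV0 hB
  rw [hB] at ht ⊢
  -- the level at which the values at `x` and at the points of the ball are compared
  obtain ⟨τ, hτ⟩ : ∃ τ : ℝ≥0, (τ : ℝ≥0∞) = min (ψ x t) (V⁻¹ : ℝ≥0) :=
    ⟨_, ENNReal.coe_toNNReal (ne_top_of_le_ne_top ENNReal.coe_ne_top (min_le_right _ _))⟩
  have hτ0 : 0 < τ := by
    rw [← ENNReal.coe_pos, hτ]
    exact lt_min (bot_lt_of_lt ht) (by simpa using hV0)
  have hτx : (τ : ℝ≥0∞) ≤ ψ x t := hτ.trans_le (min_le_left _ _)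
  have hτV : τ ≤ V⁻¹ := by
    rw [← ENNReal.coe_le_coe]; exact hτ.trans_le (min_le_right _ _)
  set A : ℝ≥0 := τ ^ p⁻¹ with hA
  have hA0 : 0 < A := NNReal.rpow_pos hτ0
  have hAw : (1 / (V : ℝ≥0∞)) * ∫⁻ y in Metric.ball c (r : ℝ), w y ≤ A := by
    rw [hA, ENNReal.coe_rpow_of_ne_zero hτ0.ne', ENNReal.le_rpow_inv_iff hp0, hτ]
    exact le_min ht.le hJ
  have hlow : ∀ᵐ y, y ∈ Metric.ball c (r : ℝ) → ((c₁ * τ : ℝ≥0) : ℝ≥0∞) ≤ ψ y (t / κ) := by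
    filter_upwards [hG] with y hy hyB
    rcases le_or_gt (ψ y (t / κ) * (nndist y x ^ n : ℝ≥0)) κ with hle | hlt
    · have := hGψ y hy x hx _ hle
      rw [mul_div_cancel₀ _ hκ.ne'] at this
      refine le_trans ?_ (hτx.trans this)
      exact_mod_cast mul_le_of_le_one_left' hc₁1
    · have hd : nndist y x ≤ 2 * r := by
        have h1 : dist y c < r := hyB
        have h2 : dist x c < r := hxc
        have h3 : dist y x ≤ ((2 * r : ℝ≥0) : ℝ) := by
          push_cast
          linarith [dist_triangle_right y x c]
        exact_mod_cast h3
      have h1 : ((c₁ : ℝ≥0) : ℝ≥0∞) ≤ ψ y (t / κ) * V := by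
        calc ((c₁ : ℝ≥0) : ℝ≥0∞) ≤ (κ * unitVol n / 2 ^ n : ℝ≥0) := ENNReal.coe_le_coe.2 hc₁κ
          _ = (unitVol n / 2 ^ n : ℝ≥0) * κ := by rw [← ENNReal.coe_mul]; congr 1; ring
          _ ≤ (unitVol n / 2 ^ n : ℝ≥0) * (ψ y (t / κ) * ((2 * r) ^ n : ℝ≥0)) := by
              refine mul_le_mul_right (hlt.le.trans ?_) _
              gcongr
          _ = ψ y (t / κ) * V := by
              rw [mul_left_comm, ← ENNReal.coe_mul]
              congr 2
              rw [mul_pow]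
              field_simp
              rw [hV]; ring
      calc ((c₁ * τ : ℝ≥0) : ℝ≥0∞) ≤ (c₁ * V⁻¹ : ℝ≥0) := by gcongr
        _ ≤ ψ y (t / κ) * V * (V⁻¹ : ℝ≥0) := by
            rw [ENNReal.coe_mul]; gcongr
        _ = ψ y (t / κ) := by
            rw [mul_assoc, ← ENNReal.coe_mul, mul_inv_cancel₀ hV0.ne', ENNReal.coe_one, mul_one]
  set a' : ℝ≥0 := (a / c₁) ^ p⁻¹ with ha'
  have hpt : ∀ᵐ y, y ∈ Metric.ball c (r : ℝ) →
      (A : ℝ≥0∞) * ‖f y‖ₑ ≤ (t / κ * A : ℝ≥0) + (t / κ * a' : ℝ≥0) * w y := by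
    filter_upwards [hlow, hinc] with y hy hyinc hyB
    rcases le_or_gt ‖f y‖₊ (t / κ) with hv | hv
    · refine le_trans ?_ le_self_add
      rw [enorm_eq_nnnorm, ← ENNReal.coe_mul, mul_comm]
      gcongr
    · refine le_trans ?_ le_add_self
      have hv0 : 0 < ‖f y‖₊ := hv.trans_le' zero_le
      have h1 := hyinc (t / κ / ‖f y‖₊) ‖f y‖₊ (div_le_one_of_le₀ hv.le zero_le)
      rw [div_mul_cancel₀ _ hv0.ne'] at h1
      have h2 : (τ : ℝ≥0∞) ≤ (a / c₁ * (t / κ / ‖f y‖₊) ^ p : ℝ≥0) * extendTop ψ y ‖f y‖ₑ := by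
        rw [enorm_eq_nnnorm, extendTop_coe]
        calc (τ : ℝ≥0∞) = (c₁⁻¹ : ℝ≥0) * (c₁ * τ : ℝ≥0) := by
              rw [← ENNReal.coe_mul, inv_mul_cancel_left₀ hc₁.ne']
          _ ≤ (c₁⁻¹ : ℝ≥0) * ((a * (t / κ / ‖f y‖₊) ^ p : ℝ≥0) * ψ y ‖f y‖₊) :=
              mul_le_mul_right ((hy hyB).trans h1) _
          _ = _ := by
              rw [← mul_assoc, ← ENNReal.coe_mul]; congr 2; ring
      have h3 : (A : ℝ≥0∞) ≤ (a' * (t / κ / ‖f y‖₊) : ℝ≥0) * w y := by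
        rw [hA, ENNReal.coe_rpow_of_ne_zero hτ0.ne']
        refine (ENNReal.rpow_le_rpow h2 (inv_nonneg.2 hp0.le)).trans_eq ?_
        rw [ENNReal.mul_rpow_of_nonneg _ _ (inv_nonneg.2 hp0.le),
          ← ENNReal.coe_rpow_of_nonneg _ (inv_nonneg.2 hp0.le), NNReal.mul_rpow,
          NNReal.rpow_rpow_inv hp0.ne']
      calc (A : ℝ≥0∞) * ‖f y‖ₑ ≤ (a' * (t / κ / ‖f y‖₊) : ℝ≥0) * w y * ‖f y‖ₑ := by gcongr
        _ = _ := by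
            rw [mul_right_comm, enorm_eq_nnnorm, ← ENNReal.coe_mul]
            congr 2
            field_simp
  have hVinv : (1 / (V : ℝ≥0∞)) * V = 1 := by
    rw [one_div, ENNReal.inv_mul_cancel (by simpa using hV0.ne') ENNReal.coe_ne_top]
  have hint : (A : ℝ≥0∞) * ((1 / (V : ℝ≥0∞)) * ∫⁻ y in Metric.ball c (r : ℝ), ‖f y‖ₑ) ≤
      A * ((1 + a') / κ * t : ℝ≥0) := by
    calc (A : ℝ≥0∞) * ((1 / (V : ℝ≥0∞)) * ∫⁻ y in Metric.ball c (r : ℝ), ‖f y‖ₑ)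
        = (1 / (V : ℝ≥0∞)) * ∫⁻ y in Metric.ball c (r : ℝ), A * ‖f y‖ₑ := by
          rw [lintegral_const_mul' _ _ ENNReal.coe_ne_top]; ring
      _ ≤ (1 / (V : ℝ≥0∞)) * ∫⁻ y in Metric.ball c (r : ℝ),
            ((t / κ * A : ℝ≥0) + (t / κ * a' : ℝ≥0) * w y) :=
          mul_le_mul_right (setLIntegral_mono_ae' measurableSet_ball hpt) _
      _ = (t / κ * A : ℝ≥0) + (t / κ * a' : ℝ≥0) *
            ((1 / (V : ℝ≥0∞)) * ∫⁻ y in Metric.ball c (r : ℝ), w y) := by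
          rw [lintegral_add_left measurable_const, setLIntegral_const, hB,
            lintegral_const_mul' _ _ ENNReal.coe_ne_top, mul_add, mul_left_comm, hVinv, mul_one,
            mul_left_comm]
      _ ≤ (t / κ * A : ℝ≥0) + (t / κ * a' : ℝ≥0) * A := by gcongr
      _ = A * ((1 + a') / κ * t : ℝ≥0) := by
          rw [← ENNReal.coe_mul, ← ENNReal.coe_mul, ← ENNReal.coe_add]
          congr 1
          ring
  have hA0' : (A : ℝ≥0∞) ≠ 0 := by simpa using hA0.ne'
  exact (ENNReal.mul_le_mul_iff_right hA0' ENNReal.coe_ne_top).1 hint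

theorem modularBounded_of_aInc (hn : 1 ≤ n) (hψ : IsWeakPhi ψ) (hd : DistControl ψ)
    (hinc : AInc ψ) : ModularBounded ψ := by
  obtain ⟨L, hL, hLψ⟩ := hψ.exists_powInc
  obtain ⟨κ, hκ, hκ1, G, hG, hGψ⟩ := hd
  obtain ⟨p, hp, hpinc⟩ := hinc
  have hp0 : 0 < p := by linarith
  obtain ⟨a, ha, hae⟩ := (aIncExp_iff hψ hp0).1 hpinc
  obtain ⟨Cp, hCp⟩ := exists_lintegral_ballMax_rpow_le hn hp
  have hω := unitVol_pos n
  set c₁ : ℝ≥0 := min 1 (κ * unitVol n / 2 ^ n) with hc₁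
  have hc₁0 : 0 < c₁ := by positivity
  set C : ℝ≥0 := (1 + (a / c₁) ^ p⁻¹) / κ with hC
  have hC0 : 0 < C := by positivity
  refine ⟨2 * C * max 1 (L * Cp), by positivity, fun f hf hf1 => ?_⟩
  have hu : AEMeasurable (fun y => extendTop ψ y ‖f y‖ₑ) volume := by
    simp only [enorm_eq_nnnorm, extendTop_coe]
    exact hψ.measurable_comp _ hf.nnnorm
  set w : EuclideanSpace ℝ (Fin n) → ℝ≥0∞ := fun y => extendTop ψ y ‖f y‖ₑ ^ p⁻¹ with hwdef
  have hw : AEMeasurable w volume := hu.pow_const _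
  have hpt : ∀ᵐ x, extendTop ψ x (maximalFn f x / (2 * C : ℝ≥0)) ≤ ballMax w x ^ p := by
    filter_upwards [hG] with x hx
    have hkey : ∀ t : ℝ≥0, ballMax w x ^ p < ψ x t → maximalFn f x ≤ (C * t : ℝ≥0) := by
      intro t ht
      refine ballMax_le_iff.2 fun c r hxc => ?_
      exact average_le_of_lt hp hκ hc₁0 (min_le_left _ _) (min_le_right _ _) hG hGψ hae hw hf1 hx
        hxc ((ENNReal.rpow_le_rpow (le_ballMax w hxc) hp0.le).trans_lt ht)
    by_contra hcon
    rw [not_le] at hcon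
    by_cases htop : maximalFn f x = ⊤
    · have h1 : ballMax w x ^ p < ⊤ := hcon.trans_le le_top
      obtain ⟨t, ht⟩ := ((hψ.tendsto_top x).eventually (lt_mem_nhds h1)).exists
      exact absurd (htop ▸ hkey t ht) (not_le.2 ENNReal.coe_lt_top)
    · obtain ⟨m, hm⟩ : ∃ m : ℝ≥0, (m : ℝ≥0∞) = maximalFn f x := ⟨_, ENNReal.coe_toNNReal htop⟩
      rw [← hm, ← ENNReal.coe_div (by positivity), extendTop_coe] at hcon
      have h1 := hkey _ hcon
      rw [← hm, ENNReal.coe_le_coe] at h1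
      have h2 : C * (m / (2 * C)) = m / 2 := by field_simp
      rw [h2] at h1
      rcases eq_or_ne m 0 with rfl | hm0
      · simp [hψ.map_zero] at hcon
      · exact absurd h1 (not_le.2 (NNReal.half_lt_self hm0))
  have hbound : ∫⁻ x, extendTop ψ x (maximalFn f x / (2 * C : ℝ≥0)) ≤ Cp := by
    calc _ ≤ ∫⁻ x, ballMax w x ^ p := lintegral_mono_ae hpt
      _ ≤ Cp * ∫⁻ x, w x ^ p := hCp w hw
      _ ≤ Cp * 1 := by
          gcongr
          simpa only [hwdef, ENNReal.rpow_inv_rpow hp0.ne'] using hf1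
      _ = Cp := mul_one _
  refine le_of_eq_of_le (lintegral_congr fun x => ?_)
    (lintegral_extendTop_div_le_one hL hLψ hbound (le_max_left _ _) (le_max_right _ _))
  congr 1
  rw [ENNReal.coe_mul (2 * C), div_eq_mul_inv, div_eq_mul_inv, div_eq_mul_inv,
    ENNReal.mul_inv (Or.inr ENNReal.coe_ne_top) (Or.inl ENNReal.coe_ne_top), mul_assoc]

end sufficiency

/-! ### Transfer of (aInc) to the limit function -/

/-- An integrable function is small at some point of any conull set, as `ℝⁿ` has infinite
measure. -/
theorem exists_le_of_integrable {n : ℕ} (hn : 1 ≤ n) {h : EuclideanSpace ℝ (Fin n) → ℝ≥0}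
    (hh : MemLp (fun x => (h x : ℝ)) 1 volume) {P : EuclideanSpace ℝ (Fin n) → Prop}
    (hP : ∀ᵐ x, P x) {ε : ℝ≥0} (hε : 0 < ε) : ∃ x, P x ∧ h x ≤ ε := by
  by_contra! hcon
  have hnt : Nontrivial (EuclideanSpace ℝ (Fin n)) :=
    Module.nontrivial_of_finrank_pos (R := ℝ) (by rw [finrank_euclideanSpace_fin]; omega)
  have : NoncompactSpace (EuclideanSpace ℝ (Fin n)) := NormedSpace.noncompactSpace ℝ _
  have h1 : ∫⁻ _ : EuclideanSpace ℝ (Fin n), (ε : ℝ≥0∞) ≤ ∫⁻ x, (h x : ℝ≥0∞) := by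
    refine lintegral_mono_ae ?_
    filter_upwards [hP] with x hx
    exact_mod_cast (hcon x hx).le
  rw [lintegral_const, measure_univ_of_isAddLeftInvariant,
    ENNReal.mul_top (by simpa using hε.ne')] at h1
  exact absurd (lintegral_coe_lt_top hh) (not_lt.2 h1)

/-- If `φ` satisfies (A2) with limit function `g` and `φ(x, t) / t ^ p` is almost increasing, then
`g(t) / t ^ p` is almost increasing for small `t`. -/
theorem exists_powInc_limit {n : ℕ} (hn : 1 ≤ n) {φ : EuclideanSpace ℝ (Fin n) → ℝ≥0 → ℝ≥0∞}
    {g : ℝ≥0 → ℝ≥0∞} (hg : IsWeakPhi (fun _ : EuclideanSpace ℝ (Fin n) => g)) {p : ℝ} (hp : 0 < p)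
    {a : ℝ≥0} (ha : 1 ≤ a) (hinc : ∀ᵐ x, PowInc p a (φ x))
    {h : EuclideanSpace ℝ (Fin n) → ℝ≥0} {β s : ℝ≥0}
    (hh : MemLp (fun x => (h x : ℝ)) 1 volume) (hβ : 0 < β) (hβ1 : β ≤ 1) (hs : 0 < s)
    (h2 : ∀ᵐ x, ∀ t : ℝ≥0, (g t ≤ s → φ x (β * t) ≤ g t + h x) ∧
      (φ x t ≤ s → g (β * t) ≤ φ x t + h x)) :
    ∃ T : ℝ≥0, 0 < T ∧ ∃ a' : ℝ≥0, a ≤ a' ∧ ∀ c t : ℝ≥0, c ≤ 1 → t ≤ T →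
      g (c * t) ≤ (a' * c ^ p : ℝ≥0) * g t := by
  have ha0 : 0 < a := zero_lt_one.trans_le ha
  set δ : ℝ≥0 := s / (2 * a) with hδ
  have hδ0 : 0 < δ := by positivity
  have haδ : a * (δ + δ) = s := by rw [hδ]; field_simp; norm_num
  have hδs : δ ≤ s := by
    calc δ ≤ 1 * (δ + δ) := by rw [one_mul]; exact le_self_add
      _ ≤ a * (δ + δ) := by gcongr
      _ = s := haδ
  have hev : ∀ᶠ t in 𝓝[>] (0 : ℝ≥0), g t < δ :=
    (hg.tendsto_zero 0).eventually (gt_mem_nhds (by simpa using hδ0))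
  obtain ⟨T, hgT, hT⟩ := (hev.and self_mem_nhdsWithin).exists
  have hββ : β * β ≤ 1 := mul_le_one' hβ1 hβ1
  have hb0 : 0 < (β * β) ^ p := NNReal.rpow_pos (by positivity)
  have hinv1 : 1 ≤ ((β * β) ^ p)⁻¹ := by
    rw [one_le_inv₀ hb0]; exact NNReal.rpow_le_one hββ hp.le
  refine ⟨T, hT, a * ((β * β) ^ p)⁻¹, le_mul_of_one_le_right zero_le hinv1, ?_⟩
  -- the estimate for dilations by less than `β²`, by evaluation at points where `h` is small
  have key : ∀ c t : ℝ≥0, c ≤ 1 → t ≤ T → g (β * β * c * t) ≤ (a * c ^ p : ℝ≥0) * g t := by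
    intro c t hc ht
    have hgt : g t ≤ δ := (hg.monotone 0 ht).trans hgT.le
    have hcp : c ^ p ≤ 1 := NNReal.rpow_le_one hc hp.le
    refine ENNReal.le_of_forall_pos_le_add fun ε hε _ => ?_
    obtain ⟨x, ⟨hx1, hx2⟩, hxh⟩ := exists_le_of_integrable hn hh (hinc.and h2)
      (ε := min δ (ε / (a + 1))) (by positivity)
    have hxδ : h x ≤ δ := hxh.trans (min_le_left _ _)
    have hxε : (a + 1) * h x ≤ ε := by
      rw [mul_comm, ← le_div_iff₀ (by positivity)]
      exact hxh.trans (min_le_right _ _)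
    have e1 : φ x (β * t) ≤ g t + h x := (hx2 t).1 (hgt.trans (by exact_mod_cast hδs))
    have e2 : φ x (c * (β * t)) ≤ (a * c ^ p : ℝ≥0) * (g t + h x) :=
      (hx1 c (β * t) hc).trans (by gcongr)
    have e3 : φ x (c * (β * t)) ≤ s := by
      refine e2.trans ?_
      calc ((a * c ^ p : ℝ≥0) : ℝ≥0∞) * (g t + h x) ≤ ((a * 1 : ℝ≥0) : ℝ≥0∞) * (δ + δ) := by
            gcongr
        _ = s := by rw [mul_one, ← haδ]; push_cast; rfl
    have e4 := (hx2 (c * (β * t))).2 e3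
    calc g (β * β * c * t) = g (β * (c * (β * t))) := by congr 1; ring
      _ ≤ φ x (c * (β * t)) + h x := e4
      _ ≤ (a * c ^ p : ℝ≥0) * (g t + h x) + h x := by gcongr
      _ = (a * c ^ p : ℝ≥0) * g t + ((a * c ^ p + 1) * h x : ℝ≥0) := by push_cast; ring
      _ ≤ (a * c ^ p : ℝ≥0) * g t + ε := by
          gcongr
          calc (a * c ^ p + 1) * h x ≤ (a * 1 + 1) * h x := by gcongr
            _ ≤ ε := by rwa [mul_one]
  intro c t hc ht
  have hcp : ((β * β) ^ p)⁻¹ * c ^ p = (c / (β * β)) ^ p := by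
    rw [NNReal.div_rpow, div_eq_mul_inv, mul_comm]
  rw [mul_assoc, hcp]
  rcases le_or_gt c (β * β) with hcβ | hcβ
  · have := key (c / (β * β)) t (div_le_one_of_le₀ hcβ zero_le) ht
    rwa [mul_div_cancel₀ _ (by positivity)] at this
  · calc g (c * t) ≤ 1 * g t := by
          rw [one_mul]; exact hg.monotone 0 (mul_le_of_le_one_left' hc)
      _ ≤ _ := by
          gcongr
          rw [← ENNReal.coe_one, ENNReal.coe_le_coe]
          refine one_le_mul ha (NNReal.one_le_rpow ?_ hp.le)
          rw [le_div_iff₀ (by positivity), one_mul]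
          exact hcβ.le

/-- The conditions (A0), (A1), (A2) and (aInc) are sufficient for the boundedness of the maximal
operator. -/
theorem modularBounded_of_a0_a1_a2_aInc {n : ℕ} (hn : 1 ≤ n)
    {φ : EuclideanSpace ℝ (Fin n) → ℝ≥0 → ℝ≥0∞} (hφ : IsWeakPhi φ) (h0 : A0 φ) (h1 : A1 φ)
    (h2 : A2 φ) (hinc : AInc φ) : ModularBounded φ := by
  obtain ⟨g, h, β, s, hg, hh, -, hβ, hβ1, hs, hA2⟩ := h2
  obtain ⟨p, hp, hpinc⟩ := hinc
  have hp0 : 0 < p := by linarith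
  obtain ⟨a, ha, hae⟩ := (aIncExp_iff hφ hp0).1 hpinc
  obtain ⟨T, hT, a', haa', hga⟩ := exists_powInc_limit hn hg hp0 ha hae hh hβ hβ1 hs hA2
  obtain ⟨t₀, D, ht₀, htT, hD, hg1, hgs, hgood⟩ := exists_glue_parameters h0 hφ hg hs hT
  have hD0 : 0 < D := zero_lt_one.trans_le hD
  have hW := isWeakPhi_glue hφ hg ht₀ hD0 hg1 hgood
  have ha' : 1 ≤ a' := ha.trans haa'
  have hG : AInc (glue φ g t₀ D) := by
    refine ⟨p, hp, (aIncExp_iff hW hp0).2 ⟨a' * a', one_le_mul ha' ha', ?_⟩⟩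
    filter_upwards [hgood, hae] with x hx hxa
    refine PowInc.glue ha' ht₀ hg1.le hx (fun c t hc => (hxa c t hc).trans (by gcongr))
      fun c t hc ht => hga c t hc (ht.trans htT)
  have hB := modularBounded_of_aInc hn hW (distControl_glue hφ hg hg1 hgood h0 h1) hG
  exact hB.of_weaklyEquivalent hW hφ
    (weaklyEquivalent_glue hφ hg hgood hD hh hβ hgs hA2).symm

end GenOrlicz

end

theorem mainTheorem1 (n : ℕ) (hn : 1 ≤ n) (φ : EuclideanSpace ℝ (Fin n) → ℝ≥0 → ℝ≥0∞)
    (hφ : GenOrlicz.IsWeakPhi φ) (h0 : GenOrlicz.A0 φ) (h1 : GenOrlicz.A1 φ)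
    (h2 : GenOrlicz.A2 φ) :
    GenOrlicz.MaximalBounded φ ↔
      ∃ ψ : EuclideanSpace ℝ (Fin n) → ℝ≥0 → ℝ≥0∞,
        GenOrlicz.IsWeakPhi ψ ∧ GenOrlicz.WeaklyEquivalent φ ψ ∧
        GenOrlicz.A0 ψ ∧ GenOrlicz.A1 ψ ∧ GenOrlicz.A2 ψ ∧ GenOrlicz.AInc ψ := by
  rw [GenOrlicz.maximalBounded_iff_modularBounded hφ]
  constructor
  · intro hb
    obtain ⟨g, h, β, s, hg, hh, -, hβ, hβ1, hs, hA2⟩ := h2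
    obtain ⟨t₀, D, ht₀, -, hD, hg1, hgs, hgood⟩ :=
      GenOrlicz.exists_glue_parameters h0 hφ hg hs one_pos
    have hD0 : 0 < D := zero_lt_one.trans_le hD
    have hW := GenOrlicz.isWeakPhi_glue hφ hg ht₀ hD0 hg1 hgood
    have hE := GenOrlicz.weaklyEquivalent_glue hφ hg hgood hD hh hβ hgs hA2
    exact ⟨GenOrlicz.glue φ g t₀ D, hW, hE, GenOrlicz.a0_glue hφ hg ht₀ hg1 hgood,
      GenOrlicz.a1_glue hφ hg hD0 hg1 hgood h1, GenOrlicz.a2_glue hφ hg ht₀ hgood,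
      GenOrlicz.aInc_of_modularBounded hn hW
        (GenOrlicz.distControl_glue hφ hg hg1 hgood h0 h1) (hb.of_weaklyEquivalent hφ hW hE)⟩
  · rintro ⟨ψ, hψ, hE, hψ0, hψ1, hψ2, hψa⟩
    exact (GenOrlicz.modularBounded_of_a0_a1_a2_aInc hn hψ hψ0 hψ1 hψ2 hψa).of_weaklyEquivalent
      hψ hφ hE.symm
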